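/- Write ${}_pF_q(\alpha_1,\dots,\alpha_p;\beta_1,\dots,\beta_q\,|\,1)=\sum_{k\ge 0}\frac{(\alpha_1)_k\cdots(\alpha_p)_k}{(\beta_1)_k\cdots(\beta_q)_k\,k!}$ with $(x)_k=x(x+1)\cdots(x+k-1)$; a series with a non-positive integer among its top parameters is the finite sum of its non-vanishing terms. Let $n\ge 1$ be an integer, and let $s,a,b,c$ be complex numbers. Put $P=\{0,-1,-2,\dots\}$ (the poles of $\Gamma$); $1/\Gamma$ is taken to be $0$ on $P$. (i) Reduction of the terminating ${}_4F_3$. If $s\ne 1$ and none of $\frac{a}{s-1}+j$, $b+1+j$, $1-a-ns+j$ vanishes for $0\le j<n$, then $${}_4F_3\left(\begin{matrix}1,\,1+\frac{a}{s-1},\,bs-a,\,-n\\ \frac{a}{s-1},\,b+1,\,1-a-ns\end{matrix}\middle|1\right)={}_3F_2\left(\begin{matrix}1,\,bs-a,\,-n\\ b+1,\,1-a-ns\end{matrix}\middle|1\right)-\frac{(s-1)(sb-a)n}{a(b+1)(1-a-ns)}\,{}_3F_2\left(\begin{matrix}2,\,1+bs-a,\,1-n\\ b+2,\,2-a-ns\end{matrix}\middle|1\right).$$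 (ii) If $s\ne 1$, $sb\neq a$ and $b,\ -a-ns,\ 1-ns+n+b-sb\notin P$, then $${}_3F_2\left(\begin{matrix}2,\,1+sb-a,\,1-n\\ b+2,\,2-a-ns\end{matrix}\middle|1\right)=\frac{(b+1)(a-1+ns)(a+ns)\,ab\,\Gamma(n)\Gamma(1-ns+n+b-sb)}{(sb-a)(s-1)\Gamma(b+n+1)\Gamma(1-a-ns+n)}\sum_{L=0}^n\frac{\Gamma(-a-ns+L)\Gamma(b+L)}{\Gamma(L+1)\Gamma(1-ns+b-sb+L)}+\frac{b(a+ns)(-1+a+ns)(b+1)}{n(s-1)(sb-a)(b+n)}.$$ In (iii)–(vi) the series on the left converges (absolutely) and has the stated value. (iii) If $b\ne1$, $c,\ a-1-n,\ c-a,\ c-a-b+2\notin P$, and either $\operatorname{Re}(c-a-b+2)>0$ or $b\in P$, then $${}_3F_2\left(\begin{matrix}a,\,a-n-1,\,b\\ c,\,a-n+1\end{matrix}\middle|1\right)=-\frac{(a-n)(a-n-1)(-bn-ac+nc+a^2-an+c-a+n)\Gamma(-b+2+c-a)\Gamma(c)\Gamma(n)}{(b-1)\Gamma(n+c+1-a)\Gamma(c-a)\Gamma(a)}\sum_{k=0}^n\frac{\Gamma(a-1-n+k)\Gamma(c-a+k)}{\Gamma(k+1)\Gamma(1-n+c-b+k)}-\frac{(a-n)(a-n-1)\Gamma(-b+2+c-a)\Gamma(c)}{n(b-1)\Gamma(c+1-b)\Gamma(c-a)}.$$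 (iv) If $a-c-b-n\neq0$ and $n+1+c+b,\ a-n+1,\ b,\ c\notin P$, then $${}_3F_2\left(\begin{matrix}a,\,b,\,c\\ n+1+c+b,\,a-n+1\end{matrix}\middle|1\right)=\frac{\Gamma(n+1+c+b)\Gamma(a-n+1)(-n^2c+n^2a-n^3-n^2b-ncb)\Gamma(n)}{(a-c-b-n)\Gamma(c)\Gamma(b)\Gamma(c+n+1)\Gamma(b+n+1)\,n}\sum_{k=0}^n\frac{\Gamma(b+k)\Gamma(c+k)}{\Gamma(k+1)\Gamma(a+1+k-n)}+\frac{\Gamma(n+1+c+b)\Gamma(a-n+1)}{n(a-c-b-n)\Gamma(1+a)\Gamma(c)\Gamma(b)}.$$ (v) If $a-n+1,\ a+2-b-c-n,\ a+1-n-c,\ a+1-n-b\notin P$, and either $\operatorname{Re}(a-b-c-n+3)>0$ or $b\in P$ or $c\in P$, then $${}_3F_2\left(\begin{matrix}a,\,b,\,c\\ 2+a,\,a-n+1\end{matrix}\middle|1\right)=\frac{Q\,\Gamma(2+a)\Gamma(a+2-b-c-n)\Gamma(a-n+1)\Gamma(n)}{n\,\Gamma(-b-n+1+a)\Gamma(2+a-b)\Gamma(2+a-c)\Gamma(1+a-c-n)}\sum_{k=0}^n\frac{\Gamma(a+k+1-n-c)\Gamma(-b-n+1+a+k)}{\Gamma(k+1)\Gamma(a+1+k-n)}+\frac{\Gamma(a+2-b-c-n)(-1-a)\Gamma(a-n+1)}{n\,\Gamma(-b-n+1+a)\Gamma(1+a-c-n)},$$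 where $Q=ncb-nc-anc-anb+n+2an-bn-n^2a+na^2$. (vi) If $a-n-b\ne0$, $c,\ a-1-n,\ c-1-n-b\notin P$, and either $\operatorname{Re}(c-1-n-b)>0$ or $b\in P$, then $${}_3F_2\left(\begin{matrix}a,\,b,\,2\\ c,\,a-n+1\end{matrix}\middle|1\right)=-\frac{(a-n-1)(a-n)(ab-b-1-2n+a-ac+nc+c)\Gamma(c)\Gamma(n)}{(a-n-b)\Gamma(a)\Gamma(c-b)}\sum_{k=0}^n\frac{\Gamma(a-1-n+k)\Gamma(c-1-n-b+k)}{\Gamma(k+1)\Gamma(c-n-1+k)}-\frac{(a-n-1)(a-n)(c-1)}{n(a-n-b)}.$$ -/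

import Mathlib

open Complex

noncomputable section

/-- The `k`-th term of the generalized hypergeometric series with top parameters `as` and bottom
parameters `bs` at the argument `z`: the product of the rising factorials `(α)_k` over the top
parameters, divided by the product of `(β)_k` over the bottom parameters and by `k!`, times `z ^ k`.
Once a top parameter has made the numerator vanish the term is zero, so that a terminating series
is the finite sum of its terms. -/
def hyperTerm (as bs : List ℂ) (z : ℂ) (k : ℕ) : ℂ :=
  (as.map fun α => (ascPochhammer ℂ k).eval α).prod /
    ((bs.map fun β => (ascPochhammer ℂ k).eval β).prod * (k.factorial : ℂ)) * z ^ k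

/-- The sum of the generalized hypergeometric series. -/
def hyperF (as bs : List ℂ) (z : ℂ) : ℂ := ∑' k : ℕ, hyperTerm as bs z k

/-- The complex number `z` is a non-positive integer, that is, a pole of the Gamma function. -/
def IsGammaPole (z : ℂ) : Prop := ∃ m : ℕ, z = -(m : ℂ)

end

/-! Every right-hand side contains a partial sum of a series of Gauss type, running up to `n`,
because an auxiliary series attached to each left-hand side satisfies a first-order inhomogeneous
recurrence in `n`. Once normalised, each step of the recurrence adds one more term to the partial
sum. The recurrences are checked termwise, either by partial fractions or by a certificate `H` with
f k = g k + H (k + 1) - H k (`hasSum_of_telescoping`). The behaviour of `H` at infinity, like all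
convergence questions, is read off from power asymptotics (`PowerGrowth`). The closed forms that
start or drive the nonterminating recurrences come from Gauss's theorem (`hasSum_gaussTerm`), itself
proved by letting the bottom parameter tend to infinity.

The auxiliary series are Bailey's series (`hasSum_baileyTerm`), Gauss series divided by a linear
factor in `k` (`hasSum_gaussTerm_div`, `hasSum_stieltjesGauss`), and series `₃F₂` with top parameter
`1`, infinite or terminating (`hasSum_threeTwoTerm_one`, `exists_hasSum_terminating`). A contiguous
relation leads from each to the series of the theorem: top parameter `2` is the weight `k + 1` on
top parameter `1`, a top and a bottom parameter differing by two leave two linear factors in a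
denominator, and the series whose bottom parameter contains all of `n`, `b`, `c` is a difference of
two consecutive Bailey series.

Terms are regularised by 1/Γ of the bottom parameters. Since 1/Γ is entire, and Lean's values Γ = 0
at a pole and 0⁻¹ = 0 agree with it, intermediate identities stay meaningful at poles. -/

open Filter Topology

noncomputable section

/-! ### Rising factorials and the Gamma function -/

/-- The rising factorial `a (a + 1) ⋯ (a + k - 1)`. -/
def rising (a : ℂ) (k : ℕ) : ℂ := (ascPochhammer ℂ k).eval a

lemma rising_zero (a : ℂ) : rising a 0 = 1 := by simp [rising]

lemma rising_succ (a : ℂ) (k : ℕ) : rising a (k + 1) = rising a k * (a + k) :=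
  ascPochhammer_succ_eval k a

lemma rising_succ_left (a : ℂ) (k : ℕ) : rising a (k + 1) = a * rising (a + 1) k := by
  simp [rising, ascPochhammer_succ_left]

lemma mul_rising_add_one (a : ℂ) (k : ℕ) : a * rising (a + 1) k = rising a k * (a + k) := by
  rw [← rising_succ_left, rising_succ]

lemma rising_eq_prod (a : ℂ) (k : ℕ) : rising a k = ∏ j ∈ Finset.range k, (a + j) := by
  induction k with
  | zero => simp [rising_zero]
  | succ k ih => rw [Finset.prod_range_succ, rising_succ, ih]

lemma rising_neg_eq_zero {m k : ℕ} (h : m < k) : rising (-(m : ℂ)) k = 0 :=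
  ascPochhammer_eval_neg_coe_nat_of_lt h

lemma rising_one (k : ℕ) : rising 1 k = (k.factorial : ℂ) := by
  induction k with
  | zero => simp [rising_zero]
  | succ k ih => rw [rising_succ, ih, Nat.factorial_succ]; push_cast; ring

lemma rising_two (k : ℕ) : rising 2 k = (k.factorial : ℂ) * (k + 1) := by
  have h := mul_rising_add_one 1 k
  rw [rising_one, one_mul, one_add_one_eq_two] at h
  rw [h, add_comm]

lemma add_nat_ne_zero {z : ℂ} (hz : ¬ IsGammaPole z) (k : ℕ) : z + k ≠ 0 :=
  fun h => hz ⟨k, eq_neg_of_add_eq_zero_left h⟩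

lemma not_isGammaPole_add_nat {z : ℂ} (hz : ¬ IsGammaPole z) (k : ℕ) :
    ¬ IsGammaPole (z + k) := by
  rintro ⟨m, hm⟩
  refine hz ⟨m + k, ?_⟩
  push_cast
  linear_combination hm

lemma not_isGammaPole_add_one {z : ℂ} (hz : ¬ IsGammaPole z) : ¬ IsGammaPole (z + 1) := by
  simpa using not_isGammaPole_add_nat hz 1

lemma ne_zero_of_not_isGammaPole {z : ℂ} (hz : ¬ IsGammaPole z) : z ≠ 0 := by
  simpa using add_nat_ne_zero hz 0

lemma not_isGammaPole_of_re_pos {z : ℂ} (hz : 0 < z.re) : ¬ IsGammaPole z := by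
  rintro ⟨m, rfl⟩
  simp only [neg_re, natCast_re] at hz
  have : (0 : ℝ) ≤ m := m.cast_nonneg
  linarith

lemma isGammaPole_sub_one {z : ℂ} (hz : IsGammaPole z) : IsGammaPole (z - 1) := by
  obtain ⟨m, rfl⟩ := hz
  exact ⟨m + 1, by push_cast; ring⟩

lemma Gamma_ne_zero_of_not_isGammaPole {z : ℂ} (hz : ¬ IsGammaPole z) : Gamma z ≠ 0 :=
  fun h => hz ((Gamma_eq_zero_iff z).1 h)

lemma rising_ne_zero {z : ℂ} (hz : ¬ IsGammaPole z) (k : ℕ) : rising z k ≠ 0 := by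
  rw [rising_eq_prod]
  exact Finset.prod_ne_zero_iff.2 fun j _ => add_nat_ne_zero hz j

lemma Gamma_add_nat {z : ℂ} (hz : ¬ IsGammaPole z) (k : ℕ) :
    Gamma (z + k) = rising z k * Gamma z := by
  induction k with
  | zero => simp [rising_zero]
  | succ k ih =>
    rw [Nat.cast_succ, ← add_assoc, Complex.Gamma_add_one _ (add_nat_ne_zero hz k), ih,
      rising_succ]
    ring

lemma inv_Gamma_eq (z : ℂ) : (Gamma z)⁻¹ = z * (Gamma (z + 1))⁻¹ := by
  simpa using one_div_Gamma_eq_self_mul_one_div_Gamma_add_one z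

/-! ### Power asymptotics, convergence and vanishing at infinity -/

/-- `f k` is asymptotically `L * k ^ e`. -/
def PowerGrowth (f : ℕ → ℂ) (e L : ℂ) : Prop :=
  Tendsto (fun k : ℕ => f k * (k : ℂ) ^ (-e)) atTop (𝓝 L)

namespace PowerGrowth

lemma congr' {f g : ℕ → ℂ} {e L : ℂ} (hf : PowerGrowth f e L) (h : f =ᶠ[atTop] g) :
    PowerGrowth g e L :=
  Tendsto.congr' (h.mono fun k hk => by simp only [hk]) hf

lemma congr {f g : ℕ → ℂ} {e e' L L' : ℂ} (hf : PowerGrowth f e L) (h : ∀ k, f k = g k)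
    (he : e = e') (hL : L = L') : PowerGrowth g e' L' := by
  subst he hL
  exact hf.congr' (Eventually.of_forall h)

lemma mul {f g : ℕ → ℂ} {e e' L L' : ℂ} (hf : PowerGrowth f e L) (hg : PowerGrowth g e' L') :
    PowerGrowth (fun k => f k * g k) (e + e') (L * L') := by
  refine Tendsto.congr' ?_ (Tendsto.mul hf hg)
  filter_upwards [eventually_ne_atTop 0] with k hk
  rw [neg_add, cpow_add _ _ (Nat.cast_ne_zero.2 hk)]
  ring

lemma const (c : ℂ) : PowerGrowth (fun _ => c) 0 c := by
  simp [PowerGrowth]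

lemma inv {f : ℕ → ℂ} {e L : ℂ} (hf : PowerGrowth f e L) (hL : L ≠ 0) :
    PowerGrowth (fun k => (f k)⁻¹) (-e) L⁻¹ := by
  refine Tendsto.congr (fun k => ?_) (Tendsto.inv₀ hf hL)
  rw [mul_inv, cpow_neg, inv_inv, neg_neg]

lemma natCast : PowerGrowth (fun k : ℕ => (k : ℂ)) 1 1 := by
  refine Tendsto.congr' ?_ tendsto_const_nhds
  filter_upwards [eventually_ne_atTop 0] with k hk
  rw [cpow_neg_one, mul_inv_cancel₀ (Nat.cast_ne_zero.2 hk)]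

lemma add_natCast (z : ℂ) : PowerGrowth (fun k : ℕ => z + k) 1 1 := by
  have h : Tendsto (fun k : ℕ => z * (k : ℂ)⁻¹ + 1) atTop (𝓝 (z * 0 + 1)) :=
    (tendsto_const_nhds.mul (tendsto_inv₀_cobounded.comp
      (tendsto_natCast_atTop_cobounded (α := ℂ)))).add tendsto_const_nhds
  rw [mul_zero, zero_add] at h
  refine Tendsto.congr' ?_ h
  filter_upwards [eventually_ne_atTop 0] with k hk
  have : (k : ℂ) ≠ 0 := Nat.cast_ne_zero.2 hk
  rw [cpow_neg_one]
  field_simp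

lemma inv_add_natCast (z : ℂ) : PowerGrowth (fun k : ℕ => (z + k)⁻¹) (-1) 1 := by
  simpa using (add_natCast z).inv one_ne_zero

lemma of_eventually_zero {f : ℕ → ℂ} (h : ∀ᶠ k in atTop, f k = 0) (e : ℂ) :
    PowerGrowth f e 0 :=
  Tendsto.congr' (h.mono fun k hk => by simp [hk]) tendsto_const_nhds

lemma tendsto_of_zero {f : ℕ → ℂ} {L : ℂ} (hf : PowerGrowth f 0 L) : Tendsto f atTop (𝓝 L) :=
  Tendsto.congr (fun k => by simp) hf

lemma isBigO {f : ℕ → ℂ} {e L : ℂ} (hf : PowerGrowth f e L) :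
    f =O[atTop] fun k : ℕ => (k : ℝ) ^ e.re := by
  have h1 : (fun k : ℕ => f k * (k : ℂ) ^ (-e)) =O[atTop] fun _ => (1 : ℝ) := hf.isBigO_one ℝ
  have h2 : (fun k : ℕ => (k : ℂ) ^ e) =O[atTop] fun k : ℕ => (k : ℝ) ^ e.re := by
    refine Asymptotics.IsBigO.of_bound 1 ?_
    filter_upwards [eventually_gt_atTop 0] with k hk
    rw [norm_natCast_cpow_of_pos hk, one_mul]
    exact le_abs_self _
  refine (Asymptotics.IsBigO.congr' (h1.mul h2) ?_ ?_)
  · filter_upwards [eventually_ne_atTop 0] with k hk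
    rw [mul_assoc, ← cpow_add _ _ (Nat.cast_ne_zero.2 hk)]
    simp
  · exact Eventually.of_forall fun k => one_mul _

lemma tendsto_zero {f : ℕ → ℂ} {e L : ℂ} (hf : PowerGrowth f e L) (he : e.re < 0) :
    Tendsto f atTop (𝓝 0) := by
  refine hf.isBigO.trans_tendsto ?_
  have := (tendsto_rpow_neg_atTop (neg_pos.2 he)).comp (tendsto_natCast_atTop_atTop (R := ℝ))
  simpa [Function.comp_def] using this

lemma summable {f : ℕ → ℂ} {e L : ℂ} (hf : PowerGrowth f e L) (he : e.re < -1) : Summable f :=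
  summable_of_isBigO_nat (Real.summable_nat_rpow.2 he) hf.isBigO

end PowerGrowth

lemma eventually_rising_eq_zero {a : ℂ} (ha : IsGammaPole a) : ∀ᶠ k in atTop, rising a k = 0 := by
  obtain ⟨m, rfl⟩ := ha
  filter_upwards [eventually_gt_atTop m] with k hk
  exact rising_neg_eq_zero hk

/-- Euler's limit for Γ, inverted. At a pole of Γ the factor is eventually zero and the constant is
zero as well, so no case distinction is passed on. -/
lemma powerGrowth_rising (a : ℂ) :
    PowerGrowth (fun k => rising a k * (k.factorial : ℂ)⁻¹) (a - 1) (Gamma a)⁻¹ := by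
  by_cases ha : IsGammaPole a
  · rw [(Gamma_eq_zero_iff a).2 ha, inv_zero]
    exact .of_eventually_zero
      ((eventually_rising_eq_zero ha).mono fun k hk => by rw [hk, zero_mul]) _
  -- Euler's sequence has k + 1 linear factors, so it governs `rising a (k + 1)`; the extra factor a
  -- + k is divided out afterwards.
  · have h : PowerGrowth (fun k => rising a (k + 1) * (k.factorial : ℂ)⁻¹) a (Gamma a)⁻¹ := by
      refine Tendsto.congr (fun k => ?_)
        ((GammaSeq_tendsto_Gamma a).inv₀ (Gamma_ne_zero_of_not_isGammaPole ha))
      rw [GammaSeq, ← rising_eq_prod, inv_div, cpow_neg, div_eq_mul_inv, mul_inv]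
      ring
    refine (h.mul (.inv_add_natCast a)).congr (fun k => ?_) (by ring) (by ring)
    rw [rising_succ]
    field_simp [add_nat_ne_zero ha k]

/-- Off the poles this is the reciprocal of `powerGrowth_rising`; the relation 1/Γ(z) = z/Γ(z + 1)
then carries it down to the poles. -/
lemma powerGrowth_inv_Gamma (c : ℂ) :
    PowerGrowth (fun k => (k.factorial : ℂ) * (Gamma (c + k))⁻¹) (1 - c) 1 := by
  have key : ∀ N : ℕ, ∀ c : ℂ, ¬ IsGammaPole (c + N) →
      PowerGrowth (fun k => (k.factorial : ℂ) * (Gamma (c + k))⁻¹) (1 - c) 1 := by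
    intro N
    induction N with
    | zero =>
      intro c hc
      rw [Nat.cast_zero, add_zero] at hc
      have hG := Gamma_ne_zero_of_not_isGammaPole hc
      refine (((powerGrowth_rising c).inv (inv_ne_zero hG)).mul (.const (Gamma c)⁻¹)).congr
        (fun k => ?_) (by ring) (by field_simp)
      rw [Gamma_add_nat hc]
      simp only [mul_inv, inv_inv]
      ring
    | succ N ih =>
      intro c hc
      have h := ih (c + 1) (by push_cast at hc; rwa [add_assoc, add_comm (1 : ℂ)])
      refine (h.mul (.add_natCast c)).congr (fun k => ?_) (by ring) (by ring)
      rw [inv_Gamma_eq (c + k), show c + 1 + (k : ℂ) = c + k + 1 by ring]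
      ring
  by_cases hc : IsGammaPole c
  · obtain ⟨m, rfl⟩ := hc
    refine key (m + 1) _ ?_
    push_cast
    rw [neg_add_cancel_left]
    exact not_isGammaPole_of_re_pos (by simp)
  · exact key 0 c (by simpa using hc)

/-- Treats convergent and terminating series alike: an eventually vanishing factor has every growth
exponent, and e = τ - 1 is one that makes the real part positive. -/
lemma exists_powerGrowth_rising {b τ : ℂ} (h : 0 < (τ - b).re ∨ IsGammaPole b) :
    ∃ e L : ℂ, PowerGrowth (fun k => rising b k * (k.factorial : ℂ)⁻¹) (e - 1) L ∧
      0 < (τ - e).re := by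
  rcases h with h | h
  · exact ⟨b, _, powerGrowth_rising b, h⟩
  · exact ⟨τ - 1, 0, .of_eventually_zero
      ((eventually_rising_eq_zero h).mono fun k hk => by rw [hk, zero_mul]) _, by simp⟩

/-! ### Telescoping and Gauss's summation theorem -/

lemma hasSum_of_telescoping {f g H : ℕ → ℂ} {S L : ℂ} (hf : Summable f) (hg : HasSum g S)
    (h : ∀ k, f k = g k + (H (k + 1) - H k)) (hH : Tendsto H atTop (𝓝 L)) :
    HasSum f (S + (L - H 0)) := by
  rw [hf.hasSum_iff_tendsto_nat]
  have h1 : ∀ N, ∑ k ∈ Finset.range N, f k = ∑ k ∈ Finset.range N, g k + (H N - H 0) := by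
    intro N
    rw [← Finset.sum_range_sub, ← Finset.sum_add_distrib]
    exact Finset.sum_congr rfl fun k _ => h k
  simp only [h1]
  exact hg.tendsto_sum_nat.add (hH.sub_const _)

/-- The `k`-th term of the regularized Gauss series `₂F₁(a, b; c | 1) / Γ(c)`. -/
def gaussTerm (a b c : ℂ) (k : ℕ) : ℂ :=
  rising a k * rising b k * (Gamma (c + k))⁻¹ * (k.factorial : ℂ)⁻¹

lemma powerGrowth_gaussTerm (a c : ℂ) {b e L : ℂ}
    (h : PowerGrowth (fun k => rising b k * (k.factorial : ℂ)⁻¹) (e - 1) L) :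
    PowerGrowth (gaussTerm a b c) (a + e - c - 1) ((Gamma a)⁻¹ * L) := by
  refine (((powerGrowth_rising a).mul h).mul (powerGrowth_inv_Gamma c)).congr
    (fun k => ?_) (by ring) (by ring)
  have : (k.factorial : ℂ) ≠ 0 := Nat.cast_ne_zero.2 k.factorial_ne_zero
  rw [gaussTerm]
  field_simp

lemma summable_gaussTerm {a b c : ℂ} (h : 0 < (c - a - b).re ∨ IsGammaPole b) :
    Summable (gaussTerm a b c) := by
  obtain ⟨e, L, hL, he⟩ := exists_powerGrowth_rising h
  refine (powerGrowth_gaussTerm a c hL).summable ?_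
  simp only [sub_re, add_re, one_re] at he ⊢
  linarith

lemma gaussTerm_eq_add_one (a b c : ℂ) (k : ℕ) :
    gaussTerm a b c k = (c + k) * gaussTerm a b (c + 1) k := by
  rw [gaussTerm, gaussTerm, inv_Gamma_eq (c + k), add_right_comm]
  ring

lemma gaussTerm_succ (a b c : ℂ) (k : ℕ) :
    (k + 1) * (c + k) * gaussTerm a b c (k + 1) = (a + k) * (b + k) * gaussTerm a b c k := by
  have : (k.factorial : ℂ) ≠ 0 := Nat.cast_ne_zero.2 k.factorial_ne_zero
  have : (k : ℂ) + 1 ≠ 0 := Nat.cast_add_one_ne_zero k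
  rw [gaussTerm, gaussTerm, inv_Gamma_eq (c + k), Nat.cast_succ, ← add_assoc, rising_succ,
    rising_succ, Nat.factorial_succ]
  push_cast
  field_simp

lemma tsum_gaussTerm_step {a b c : ℂ} (h : 0 < (c - a - b).re ∨ IsGammaPole b) :
    (c - a - b) * ∑' k, gaussTerm a b c k =
      (c - a) * (c - b) * ∑' k, gaussTerm a b (c + 1) k := by
  have h' : 0 < (c + 1 - a - b).re ∨ IsGammaPole b := by
    refine h.imp_left fun h => ?_
    simp only [sub_re, add_re, one_re] at h ⊢
    linarith
  -- The certificate for the step c → c + 1. It vanishes at k = 0, and it tends to zero at infinity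
  -- because of the convergence condition.
  have hlim : Tendsto (fun k : ℕ => k * (c + k) * gaussTerm a b (c + 1) k) atTop (𝓝 0) := by
    obtain ⟨e, L, hL, he⟩ := exists_powerGrowth_rising h
    refine ((PowerGrowth.natCast.mul (.add_natCast c)).mul
      (powerGrowth_gaussTerm a (c + 1) hL)).tendsto_zero ?_
    simp only [sub_re, add_re, one_re] at he ⊢
    linarith
  have := hasSum_of_telescoping ((summable_gaussTerm h').mul_left ((c - a) * (c - b)))
    ((summable_gaussTerm h).hasSum.mul_left (c - a - b)) (fun k => ?_) hlim
  · rw [← tsum_mul_left (a := (c - a) * (c - b)), this.tsum_eq]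
    simp
  · have h1 := gaussTerm_succ a b (c + 1) k
    rw [gaussTerm_eq_add_one a b c k]
    push_cast
    linear_combination -h1

lemma tsum_gaussTerm_iterate {a b c : ℂ} (hs : ¬ IsGammaPole (c - a - b))
    (h : 0 < (c - a - b).re ∨ IsGammaPole b) (N : ℕ) :
    ∑' k, gaussTerm a b c k = Gamma (c - a - b) * (rising (c - a) N * rising (c - b) N *
      (Gamma (c - a - b + N))⁻¹ * ∑' k, gaussTerm a b (c + N) k) := by
  induction N with
  | zero =>
    have := Gamma_ne_zero_of_not_isGammaPole hs
    simp only [rising_zero, Nat.cast_zero, add_zero]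
    field_simp
  | succ N ih =>
    have hN : 0 < (c + N - a - b).re ∨ IsGammaPole b := by
      refine h.imp_left fun h => ?_
      have : (0 : ℝ) ≤ N := N.cast_nonneg
      simp only [sub_re, add_re, natCast_re] at h ⊢
      linarith
    have h1 := tsum_gaussTerm_step hN
    have h2 : (Gamma (c - a - b + N))⁻¹ = _ := inv_Gamma_eq _
    rw [ih, rising_succ, rising_succ, h2]
    push_cast
    rw [← add_assoc, ← add_assoc]
    linear_combination Gamma (c - a - b) * rising (c - a) N * rising (c - b) N *
      (Gamma (c - a - b + N + 1))⁻¹ * h1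

lemma tendsto_inv_rising_add_nat (c : ℂ) (k : ℕ) :
    Tendsto (fun N : ℕ => (rising (c + N) k)⁻¹) atTop (𝓝 (if k = 0 then 1 else 0)) := by
  induction k with
  | zero => simp [rising_zero]
  | succ k ih =>
    have h : Tendsto (fun N : ℕ => (c + k + N)⁻¹) atTop (𝓝 0) :=
      (PowerGrowth.inv_add_natCast (c + k)).tendsto_zero (by simp)
    have := ih.mul h
    rw [mul_zero] at this
    simp only [Nat.add_eq_zero_iff, one_ne_zero, and_false, if_false]
    refine this.congr fun N => ?_
    rw [rising_succ, mul_inv, add_right_comm]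

lemma norm_rising_le {ρ : ℝ} (hρ : 0 < ρ) {z : ℂ} (hz : ρ ≤ z.re) (k : ℕ) :
    ‖rising ρ k‖ ≤ ‖rising z k‖ := by
  rw [rising_eq_prod, rising_eq_prod, norm_prod, norm_prod]
  refine Finset.prod_le_prod (fun _ _ => norm_nonneg _) fun j _ => ?_
  have h0 : (0 : ℝ) ≤ j := j.cast_nonneg
  have h1 : ‖(ρ : ℂ) + j‖ = ρ + j := by
    rw [← ofReal_natCast, ← ofReal_add, norm_real, Real.norm_of_nonneg (by linarith)]
  rw [h1]
  refine le_trans ?_ (re_le_norm _)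
  simpa using hz

/-- As the bottom parameter tends to infinity, every term of ₂F₁ except the one at k = 0 tends to
zero. -/
lemma tendsto_gauss_add_nat (a b c : ℂ) :
    Tendsto (fun N : ℕ => Gamma (c + N) * ∑' k, gaussTerm a b (c + N) k) atTop (𝓝 1) := by
  obtain ⟨M, hM⟩ := exists_nat_gt (max (-c.re) (a + b - c).re)
  obtain ⟨hM1, hM2⟩ := max_lt_iff.1 hM
  simp only [sub_re, add_re] at hM2
  -- ρ is positive and exceeds Re(a + b), so the series with bottom parameter ρ converges
  -- absolutely; it dominates all those with bottom parameter c + N, N ≥ M.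
  set ρ : ℝ := c.re + M with hρ
  have hρ0 : 0 < ρ := by linarith
  have hρp : ¬ IsGammaPole (ρ : ℂ) := not_isGammaPole_of_re_pos (by simpa using hρ0)
  have hsum : Summable (fun k => Gamma ρ * gaussTerm a b ρ k) := by
    refine (summable_gaussTerm (Or.inl ?_)).mul_left _
    simp only [sub_re, ofReal_re]
    linarith
  have key : ∀ z : ℂ, ¬ IsGammaPole z → ∀ k, Gamma z * gaussTerm a b z k =
      rising a k * rising b k * (k.factorial : ℂ)⁻¹ * (rising z k)⁻¹ := by
    intro z hz k
    have h1 := Gamma_ne_zero_of_not_isGammaPole hz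
    have h2 := rising_ne_zero hz k
    rw [gaussTerm, Gamma_add_nat hz]
    field_simp
  have hlim := tendsto_tsum_of_dominated_convergence (𝓕 := atTop)
    (f := fun (N : ℕ) k => Gamma (c + N) * gaussTerm a b (c + N) k)
    (g := fun k => if k = 0 then (1 : ℂ) else 0) hsum.norm ?_ ?_
  · rw [tsum_ite_eq] at hlim
    exact hlim.congr fun N => tsum_mul_left
  · intro k
    have h := (tendsto_inv_rising_add_nat c k).const_mul
      (rising a k * rising b k * (k.factorial : ℂ)⁻¹)
    have h2 : rising a k * rising b k * (k.factorial : ℂ)⁻¹ * (if k = 0 then (1 : ℂ) else 0) =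
        if k = 0 then 1 else 0 := by
      rcases k with _ | k <;> simp [rising_zero]
    rw [h2] at h
    refine h.congr' ?_
    filter_upwards [eventually_ge_atTop M] with N hN
    refine (key _ (not_isGammaPole_of_re_pos ?_) k).symm
    have : (M : ℝ) ≤ N := Nat.cast_le.2 hN
    simp only [add_re, natCast_re]
    linarith
  · filter_upwards [eventually_ge_atTop M] with N hN k
    have hMN : (M : ℝ) ≤ N := Nat.cast_le.2 hN
    have hre : ρ ≤ (c + N).re := by
      simp only [add_re, natCast_re]
      linarith
    have hpos : 0 < ‖rising (ρ : ℂ) k‖ := norm_pos_iff.2 (rising_ne_zero hρp k)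
    rw [key _ (not_isGammaPole_of_re_pos (hρ0.trans_le hre)), key _ hρp, norm_mul,
      norm_mul _ (rising (ρ : ℂ) k)⁻¹, norm_inv (rising _ k), norm_inv (rising _ k)]
    gcongr
    exact norm_rising_le hρ0 hre k

/-- Gauss's summation theorem, in regularized form. -/
theorem hasSum_gaussTerm {a b c : ℂ} (hs : ¬ IsGammaPole (c - a - b))
    (h : 0 < (c - a - b).re ∨ IsGammaPole b) :
    HasSum (gaussTerm a b c) (Gamma (c - a - b) * ((Gamma (c - a))⁻¹ * (Gamma (c - b))⁻¹)) := by
  have hS := (summable_gaussTerm h).hasSum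
  convert! hS using 1
  have hA : Tendsto (fun N => (rising (c - a) N * (N.factorial : ℂ)⁻¹) *
      (rising (c - b) N * (N.factorial : ℂ)⁻¹) *
      ((N.factorial : ℂ) * (Gamma (c - a - b + N))⁻¹) *
      ((N.factorial : ℂ) * (Gamma (c + N))⁻¹)) atTop
      (𝓝 ((Gamma (c - a))⁻¹ * (Gamma (c - b))⁻¹)) :=
    ((((powerGrowth_rising (c - a)).mul (powerGrowth_rising (c - b))).mul
      (powerGrowth_inv_Gamma (c - a - b))).mul (powerGrowth_inv_Gamma c)).congr
      (fun _ => rfl) (by ring) (by ring) |>.tendsto_of_zero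
  have hB := (hA.mul (tendsto_gauss_add_nat a b c)).const_mul (Gamma (c - a - b))
  rw [mul_one] at hB
  -- By `tsum_gaussTerm_iterate` the sequence in `hB` is eventually constant, equal to the sum of
  -- the series.
  refine tendsto_nhds_unique hB (tendsto_const_nhds.congr' ?_)
  obtain ⟨M, hM⟩ := exists_nat_gt (-c.re)
  filter_upwards [eventually_ge_atTop M] with N hN
  have hMN : (M : ℝ) ≤ N := Nat.cast_le.2 hN
  have hG : Gamma (c + N) ≠ 0 :=
    Gamma_ne_zero_of_re_pos (by simp only [add_re, natCast_re]; linarith)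
  have hN! : (N.factorial : ℂ) ≠ 0 := Nat.cast_ne_zero.2 N.factorial_ne_zero
  rw [tsum_gaussTerm_iterate hs h N]
  field_simp

/-! ### Regularised ₃F₂ series and Bailey's formula -/

lemma hyperTerm_three_two (a b c d e : ℂ) (k : ℕ) :
    hyperTerm [a, b, c] [d, e] 1 k =
      rising a k * rising b k * rising c k * (rising d k)⁻¹ * (rising e k)⁻¹ *
        (k.factorial : ℂ)⁻¹ := by
  simp only [hyperTerm, List.map_cons, List.map_nil, List.prod_cons, List.prod_nil, one_pow,
    mul_one, rising, div_eq_mul_inv, mul_inv]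
  ring

lemma inv_rising_eq {z : ℂ} (hz : ¬ IsGammaPole z) (k : ℕ) :
    (rising z k)⁻¹ = Gamma z * (Gamma (z + k))⁻¹ := by
  have := Gamma_ne_zero_of_not_isGammaPole hz
  rw [Gamma_add_nat hz]
  field_simp

/-- The `k`-th term of the regularized series `₃F₂(a, b, c; d, e | 1) / (Γ(d) Γ(e))`. -/
def threeTwoTerm (a b c d e : ℂ) (k : ℕ) : ℂ :=
  rising a k * rising b k * rising c k * (Gamma (d + k))⁻¹ * (Gamma (e + k))⁻¹ *
    (k.factorial : ℂ)⁻¹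

lemma powerGrowth_threeTwoTerm_of_powerGrowth (a c d e : ℂ) {b ε L : ℂ}
    (h : PowerGrowth (fun k => rising b k * (k.factorial : ℂ)⁻¹) (ε - 1) L) :
    PowerGrowth (threeTwoTerm a b c d e) (a + ε + c - d - e - 1)
      ((Gamma a)⁻¹ * L * (Gamma c)⁻¹) := by
  refine (((((powerGrowth_rising a).mul h).mul (powerGrowth_rising c)).mul
    (powerGrowth_inv_Gamma d)).mul (powerGrowth_inv_Gamma e)).congr
    (fun k => ?_) (by ring) (by ring)
  have : (k.factorial : ℂ) ≠ 0 := Nat.cast_ne_zero.2 k.factorial_ne_zero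
  rw [threeTwoTerm]
  field_simp

lemma powerGrowth_threeTwoTerm (a b c d e : ℂ) :
    PowerGrowth (threeTwoTerm a b c d e) (a + b + c - d - e - 1)
      ((Gamma a)⁻¹ * (Gamma b)⁻¹ * (Gamma c)⁻¹) :=
  powerGrowth_threeTwoTerm_of_powerGrowth a c d e (powerGrowth_rising b)

lemma threeTwoTerm_succ (a b c d e : ℂ) (k : ℕ) :
    (k + 1) * (d + k) * (e + k) * threeTwoTerm a b c d e (k + 1) =
      (a + k) * (b + k) * (c + k) * threeTwoTerm a b c d e k := by
  have h : ((k : ℂ) + 1) * ((k : ℂ) + 1)⁻¹ = 1 := mul_inv_cancel₀ (Nat.cast_add_one_ne_zero k)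
  have hd := inv_Gamma_eq (d + k)
  have he := inv_Gamma_eq (e + k)
  rw [threeTwoTerm, threeTwoTerm, hd, he, Nat.cast_succ, ← add_assoc, ← add_assoc, rising_succ,
    rising_succ, rising_succ, Nat.factorial_succ, Nat.cast_mul, mul_inv, Nat.cast_succ]
  generalize (Gamma (d + k + 1))⁻¹ = D
  generalize (Gamma (e + k + 1))⁻¹ = E
  linear_combination (d + k) * (e + k) * (rising a k * (a + k)) * (rising b k * (b + k)) *
    (rising c k * (c + k)) * D * E * (k.factorial : ℂ)⁻¹ * h

lemma threeTwoTerm_eq_add_one_bottom (a b c d e : ℂ) (k : ℕ) :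
    threeTwoTerm a b c d e k = (e + k) * threeTwoTerm a b c d (e + 1) k := by
  rw [threeTwoTerm, threeTwoTerm, inv_Gamma_eq (e + k), add_right_comm]
  ring

lemma mul_threeTwoTerm_add_one_top (a b c d e : ℂ) (k : ℕ) :
    c * threeTwoTerm a b (c + 1) d e k = (c + k) * threeTwoTerm a b c d e k := by
  rw [threeTwoTerm, threeTwoTerm]
  linear_combination rising a k * rising b k * (Gamma (d + k))⁻¹ * (Gamma (e + k))⁻¹ *
    (k.factorial : ℂ)⁻¹ * mul_rising_add_one c k

/-- The bottom parameters exceed the top ones by exactly 1 in total, whatever `b`, `c`, `f` are, so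
convergence needs no condition. -/
lemma summable_baileyTerm (b c f : ℂ) (n : ℕ) :
    Summable (threeTwoTerm b c (f + n) f (b + c + n + 1)) := by
  refine (powerGrowth_threeTwoTerm b c (f + n) f (b + c + n + 1)).summable ?_
  simp only [sub_re, add_re, natCast_re, one_re]
  linarith

lemma hasSum_baileyTerm_succ {b c f S : ℂ} {n : ℕ} (hf : ¬ IsGammaPole f)
    (hS : HasSum (threeTwoTerm b c (f + n) f (b + c + n + 1)) S) :
    HasSum (fun k => (b + n + 1) * (c + n + 1) *
        threeTwoTerm b c (f + (n + 1 : ℕ)) f (b + c + (n + 1 : ℕ) + 1) k)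
      ((n + 1) * S + (Gamma b)⁻¹ * (Gamma c)⁻¹ * (Gamma (f + n + 1))⁻¹) := by
  have hfn : f + n ≠ 0 := add_nat_ne_zero hf n
  set T := threeTwoTerm b c (f + n) f (b + c + n + 1 + 1) with hT
  -- With the bottom parameter raised by one, `T` decays like k ^ (-3), so `H` has a limit that need
  -- not vanish. This limit is the inhomogeneous term of the recurrence; `H 0` is zero.
  set H : ℕ → ℂ := fun k => (f + n)⁻¹ * (k * (f - 1 + k) * (b + c + n + 1 + k) * T k) with hH
  have hlim : Tendsto H atTop (𝓝 ((Gamma b)⁻¹ * (Gamma c)⁻¹ * (Gamma (f + n + 1))⁻¹)) := by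
    refine (((PowerGrowth.const (f + n)⁻¹).mul (((PowerGrowth.natCast.mul
      (.add_natCast (f - 1))).mul (.add_natCast (b + c + n + 1))).mul
      (powerGrowth_threeTwoTerm b c (f + n) f (b + c + n + 1 + 1)))).congr (fun k => rfl)
      (by ring) ?_).tendsto_of_zero
    rw [inv_Gamma_eq (f + n)]
    field_simp
  have h := hasSum_of_telescoping ((summable_baileyTerm b c f (n + 1)).mul_left
    ((b + n + 1) * (c + n + 1))) (hS.mul_left ((n : ℂ) + 1)) (fun k => ?_) hlim
  · simpa [hH] using h
  · have h1 := threeTwoTerm_succ b c (f + n) f (b + c + n + 1 + 1) k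
    have h2 := mul_threeTwoTerm_add_one_top b c (f + n) f (b + c + n + 1 + 1) k
    rw [threeTwoTerm_eq_add_one_bottom b c (f + n) f (b + c + n + 1) k]
    rw [show f + ((n + 1 : ℕ) : ℂ) = f + n + 1 by push_cast; ring,
      show b + c + ((n + 1 : ℕ) : ℂ) + 1 = b + c + n + 1 + 1 by push_cast; ring]
    simp only [hH]
    rw [← hT] at h1 h2 ⊢
    push_cast
    apply mul_left_cancel₀ hfn
    linear_combination (b + n + 1) * (c + n + 1) * h2 - h1 -
      ((k + 1) * (f - 1 + (k + 1)) * (b + c + n + 1 + (k + 1)) * T (k + 1) -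
        k * (f - 1 + k) * (b + c + n + 1 + k) * T k) * mul_inv_cancel₀ hfn

/-- Bailey's formula for the partial sums of a Gauss series as a `₃F₂(1)`. -/
lemma hasSum_baileyTerm {b c f : ℂ} (hf : ¬ IsGammaPole f) (hb : ¬ IsGammaPole b)
    (hc : ¬ IsGammaPole c) (n : ℕ) :
    HasSum (threeTwoTerm b c (f + n) f (b + c + n + 1))
      (n.factorial * (Gamma (b + n + 1))⁻¹ * (Gamma (c + n + 1))⁻¹ *
      ∑ m ∈ Finset.range (n + 1),
        rising b m * rising c m * (Gamma (f + m))⁻¹ * (m.factorial : ℂ)⁻¹) := by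
  induction n with
  | zero =>
    have h := (hasSum_gaussTerm (a := b) (b := c) (c := b + c + 1)
      (by rw [show b + c + 1 - b - c = 1 by ring]; exact not_isGammaPole_of_re_pos (by simp))
      (Or.inl (by rw [show b + c + 1 - b - c = 1 by ring]; simp))).mul_left (Gamma f)⁻¹
    convert! h using 1
    · funext k
      have := rising_ne_zero hf k
      simp only [threeTwoTerm, gaussTerm, Gamma_add_nat hf, Nat.cast_zero, add_zero]
      field_simp
    · rw [show b + c + 1 - b - c = 1 by ring, show b + c + 1 - b = c + 1 by ring,
        show b + c + 1 - c = b + 1 by ring]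
      simp [rising_zero]
      ring
  | succ n ih =>
    have hb' : b + n + 1 ≠ 0 := by simpa [add_assoc] using add_nat_ne_zero hb (n + 1)
    have hc' : c + n + 1 ≠ 0 := by simpa [add_assoc] using add_nat_ne_zero hc (n + 1)
    have h := (hasSum_baileyTerm_succ hf ih).mul_left ((b + n + 1) * (c + n + 1))⁻¹
    have hbG := Gamma_ne_zero_of_not_isGammaPole hb
    have hcG := Gamma_ne_zero_of_not_isGammaPole hc
    have hbG' := Gamma_ne_zero_of_not_isGammaPole
      (not_isGammaPole_add_one (not_isGammaPole_add_nat hb n))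
    have hcG' := Gamma_ne_zero_of_not_isGammaPole
      (not_isGammaPole_add_one (not_isGammaPole_add_nat hc n))
    have hn! : (n.factorial : ℂ) ≠ 0 := Nat.cast_ne_zero.2 n.factorial_ne_zero
    have hn1 : (n : ℂ) + 1 ≠ 0 := Nat.cast_add_one_ne_zero n
    convert! h using 1
    · funext k
      field_simp
    · rw [Finset.sum_range_succ _ (n + 1)]
      generalize ∑ m ∈ Finset.range (n + 1),
      rising b m * rising c m * (Gamma (f + m))⁻¹ * (m.factorial : ℂ)⁻¹ = T
      have e1 := Gamma_add_nat hb (n + 1)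
      have e2 := Gamma_add_nat hc (n + 1)
      push_cast at e1 e2 ⊢
      rw [← add_assoc] at e1 e2
      have r1 : rising b (n + 1) = Gamma (b + n + 1) * (Gamma b)⁻¹ := by rw [e1]; field_simp
      have r2 : rising c (n + 1) = Gamma (c + n + 1) * (Gamma c)⁻¹ := by rw [e2]; field_simp
      rw [r1, r2, Nat.factorial_succ, ← add_assoc, ← add_assoc, ← add_assoc,
        Complex.Gamma_add_one _ hb', Complex.Gamma_add_one _ hc']
      push_cast
      field_simp

/-- The evaluation of `₃F₂(a, b, c; n + 1 + c + b, a - n + 1 | 1)`. -/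
lemma hasSum_balanced_two {n : ℕ} (hn : 0 < n) {a b c : ℂ} (h0 : a - c - b - n ≠ 0)
    (hd : ¬ IsGammaPole (n + 1 + c + b)) (hf : ¬ IsGammaPole (a - n + 1))
    (hb : ¬ IsGammaPole b) (hc : ¬ IsGammaPole c) :
    HasSum (hyperTerm [a, b, c] [n + 1 + c + b, a - n + 1] 1)
        (Gamma (n + 1 + c + b) * Gamma (a - n + 1) *
            (-(n : ℂ) ^ 2 * c + (n : ℂ) ^ 2 * a - (n : ℂ) ^ 3 - (n : ℂ) ^ 2 * b - n * c * b) *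
            Gamma n *
            (∑ k ∈ Finset.range (n + 1),
              Gamma (b + k) * Gamma (c + k) / (Gamma (k + 1) * Gamma (a + 1 + k - n))) /
            ((a - c - b - n) * Gamma c * Gamma b * Gamma (c + n + 1) * Gamma (b + n + 1) * n) +
          Gamma (n + 1 + c + b) * Gamma (a - n + 1) /
            (n * (a - c - b - n) * Gamma (1 + a) * Gamma c * Gamma b)) := by
  obtain ⟨N, rfl⟩ : ∃ N, n = N + 1 := ⟨n - 1, by omega⟩
  obtain ⟨f, rfl⟩ : ∃ f, a = f + N := ⟨a - N, by ring⟩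
  have ef : f + N - ((N + 1 : ℕ) : ℂ) + 1 = f := by push_cast; ring
  have ed : ((N + 1 : ℕ) : ℂ) + 1 + c + b = b + c + (N + 1 : ℕ) + 1 := by ring
  rw [ef] at hf ⊢
  rw [ed] at hd ⊢
  have hfN : f + N ≠ 0 := add_nat_ne_zero hf N
  have hN1 : (N : ℂ) + 1 ≠ 0 := Nat.cast_add_one_ne_zero N
  have hN! : (N.factorial : ℂ) ≠ 0 := Nat.cast_ne_zero.2 N.factorial_ne_zero
  have hbN : b + N + 1 ≠ 0 := by simpa [add_assoc] using add_nat_ne_zero hb (N + 1)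
  have hcN : c + N + 1 ≠ 0 := by simpa [add_assoc] using add_nat_ne_zero hc (N + 1)
  -- For terms `T` with top parameter f + N and bottom parameter b + c + N + 2, the two Bailey terms
  -- are (f + N + k) T, after the scaling by f + N, and (b + c + N + 1 + k) T. The variable `k`
  -- cancels in the difference and leaves the factor a - c - b - n.
  have h1 := (hasSum_baileyTerm hf hb hc (N + 1)).mul_left (f + N)
  have h2 := hasSum_baileyTerm hf hb hc N
  have hdG := Gamma_ne_zero_of_not_isGammaPole hd
  have hfG := Gamma_ne_zero_of_not_isGammaPole hf
  have hbG := Gamma_ne_zero_of_not_isGammaPole hb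
  have hcG := Gamma_ne_zero_of_not_isGammaPole hc
  have hbG' := Gamma_ne_zero_of_not_isGammaPole
      (not_isGammaPole_add_one (not_isGammaPole_add_nat hb N))
  have hcG' := Gamma_ne_zero_of_not_isGammaPole
      (not_isGammaPole_add_one (not_isGammaPole_add_nat hc N))
  have hfG' := Gamma_ne_zero_of_not_isGammaPole
      (not_isGammaPole_add_one (not_isGammaPole_add_nat hf N))
  convert! (h1.sub h2).mul_left
    (Gamma f * Gamma (b + c + (N + 1 : ℕ) + 1) / (f + N - c - b - (N + 1 : ℕ))) using 1
  · funext k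
    rw [hyperTerm_three_two, inv_rising_eq hd, inv_rising_eq hf]
    have e1 := mul_threeTwoTerm_add_one_top b c (f + N) f (b + c + N + 1 + 1) k
    have e2 := threeTwoTerm_eq_add_one_bottom b c (f + N) f (b + c + N + 1) k
    have e3 : rising (f + N) k * rising b k * rising c k *
        (Gamma (b + c + N + 1 + 1) * (Gamma (b + c + N + 1 + 1 + k))⁻¹) *
        (Gamma f * (Gamma (f + k))⁻¹) * (k.factorial : ℂ)⁻¹ =
        Gamma f * Gamma (b + c + N + 1 + 1) *
          threeTwoTerm b c (f + N) f (b + c + N + 1 + 1) k := by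
      rw [threeTwoTerm]
      ring
    push_cast at h0 ⊢
    simp only [← add_assoc] at h0 ⊢
    rw [e1, e2, e3, div_mul_eq_mul_div, eq_div_iff h0]
    ring
  · have eS : ∑ k ∈ Finset.range (N + 1 + 1), Gamma (b + k) * Gamma (c + k) /
        (Gamma (k + 1) * Gamma (f + N + 1 + k - (N + 1 : ℕ))) = Gamma b * Gamma c *
        ∑ m ∈ Finset.range (N + 1 + 1),
          rising b m * rising c m * (Gamma (f + m))⁻¹ * (m.factorial : ℂ)⁻¹ := by
      rw [Finset.mul_sum]
      refine Finset.sum_congr rfl fun m _ => ?_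
      rw [Gamma_add_nat hb, Gamma_add_nat hc, Gamma_nat_eq_factorial,
        show f + N + 1 + m - ((N + 1 : ℕ) : ℂ) = f + m by push_cast; ring]
      field_simp
    have eN : Gamma ((N + 1 : ℕ) : ℂ) = N.factorial := by
      rw [Nat.cast_succ, Gamma_nat_eq_factorial]
    rw [eS, eN, Finset.sum_range_succ _ (N + 1)]
    generalize ∑ m ∈ Finset.range (N + 1),
      rising b m * rising c m * (Gamma (f + m))⁻¹ * (m.factorial : ℂ)⁻¹ = T
    have e1 := Gamma_add_nat hb (N + 1)
    have e2 := Gamma_add_nat hc (N + 1)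
    push_cast at e1 e2 h0 ⊢
    rw [← add_assoc] at e1 e2
    have r1 : rising b (N + 1) = Gamma (b + N + 1) * (Gamma b)⁻¹ := by rw [e1]; field_simp
    have r2 : rising c (N + 1) = Gamma (c + N + 1) * (Gamma c)⁻¹ := by rw [e2]; field_simp
    rw [r1, r2, Nat.factorial_succ]
    simp only [← add_assoc]
    rw [Complex.Gamma_add_one _ hbN, Complex.Gamma_add_one _ hcN,
      show 1 + f + (N : ℂ) = f + N + 1 by ring]
    push_cast
    field_simp
    ring

/-! ### Gauss series divided by linear factors, with one top parameter shifted by n -/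

lemma mul_gaussTerm_add_one_left (a b c : ℂ) (k : ℕ) :
    a * gaussTerm (a + 1) b c k = (a + k) * gaussTerm a b c k := by
  rw [gaussTerm, gaussTerm]
  linear_combination rising b k * (Gamma (c + k))⁻¹ * (k.factorial : ℂ)⁻¹ * mul_rising_add_one a k

lemma mul_gaussTerm_add_one_right (a b c : ℂ) (k : ℕ) :
    b * gaussTerm a (b + 1) c k = (b + k) * gaussTerm a b c k := by
  rw [gaussTerm, gaussTerm]
  linear_combination rising a k * (Gamma (c + k))⁻¹ * (k.factorial : ℂ)⁻¹ * mul_rising_add_one b k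

lemma rising_mul_inv_rising_add_two {z : ℂ} (hz : ¬ IsGammaPole z) (k : ℕ) :
    rising z k * (rising (z + 2) k)⁻¹ = z * (z + 1) * ((z + k)⁻¹ * (z + 1 + k)⁻¹) := by
  have h1 := mul_rising_add_one z k
  have h2 := mul_rising_add_one (z + 1) k
  rw [show z + 1 + 1 = z + 2 by ring] at h2
  have hz1 := not_isGammaPole_add_one hz
  have h3 := rising_ne_zero (not_isGammaPole_add_one hz1) k
  rw [show z + 1 + 1 = z + 2 by ring] at h3
  have h4 := add_nat_ne_zero hz k
  have h5 := add_nat_ne_zero hz1 k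
  field_simp
  linear_combination -(z + 1 + k) * h1 - z * h2

/-- The sum of the series `∑ (α + n)_k (β)_k / (Γ(γ + n + k) k! (α - 1 + k))`. -/
lemma hasSum_gaussTerm_div {α β γ : ℂ} (hα : ¬ IsGammaPole (α - 1)) (hγ : ¬ IsGammaPole (γ - α))
    (hσ : ¬ IsGammaPole (γ + 1 - α - β)) (h : 0 < (γ + 1 - α - β).re ∨ IsGammaPole β) (n : ℕ) :
    HasSum (fun k => gaussTerm (α + n) β (γ + n) k * (α - 1 + k)⁻¹)
      (n.factorial * Gamma (γ + 1 - α - β) *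
        (Gamma (γ - α) * Gamma (γ - α + n + 1) * Gamma (α + n))⁻¹ *
        ∑ k ∈ Finset.range (n + 1), Gamma (α - 1 + k) * Gamma (γ - α + k) *
          (k.factorial * Gamma (γ - β + k))⁻¹) := by
  have hα0 := ne_zero_of_not_isGammaPole hα
  have hα' : ¬ IsGammaPole α := by simpa using not_isGammaPole_add_one hα
  have hαG := Gamma_ne_zero_of_not_isGammaPole hα
  have hγG := Gamma_ne_zero_of_not_isGammaPole hγ
  have hγ0 := ne_zero_of_not_isGammaPole hγ
  induction n with
  | zero =>
    have h1 := (hasSum_gaussTerm (a := α - 1) (b := β) (c := γ)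
      (by rwa [show γ - (α - 1) - β = γ + 1 - α - β by ring])
      (by rwa [show γ - (α - 1) - β = γ + 1 - α - β by ring])).mul_left (α - 1)⁻¹
    convert! h1 using 1
    · funext k
      have h2 := mul_gaussTerm_add_one_left (α - 1) β γ k
      have h3 := add_nat_ne_zero hα k
      rw [sub_add_cancel] at h2
      simp only [Nat.cast_zero, add_zero]
      field_simp
      linear_combination h2
    · have e1 := Complex.Gamma_add_one _ hα0
      rw [sub_add_cancel] at e1
      rw [show γ - (α - 1) - β = γ + 1 - α - β by ring, show γ - (α - 1) = γ - α + 1 by ring]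
      simp only [Nat.cast_zero, add_zero, zero_add, Finset.sum_range_one, Nat.factorial_zero,
        Nat.cast_one, one_mul, e1, Complex.Gamma_add_one _ hγ0, mul_inv]
      field_simp
  | succ n ih =>
    have hαn := add_nat_ne_zero hα' n
    have hγn : γ - α + n + 1 ≠ 0 := by simpa [add_assoc] using add_nat_ne_zero hγ (n + 1)
    have eσ : γ + n + 1 - (α + n) - β = γ + 1 - α - β := by ring
    -- Partial fractions suffice here: (γ - α + n + 1)(α + n + k) - (n + 1)(γ + n + k) is (γ - α)(α
    -- - 1 + k), so what remains after division by α - 1 + k is a pure Gauss series, whose parameter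
    -- excess does not depend on `n`.
    have h1 := hasSum_gaussTerm (a := α + n) (b := β) (c := γ + n + 1) (by rwa [eσ]) (by rwa [eσ])
    have h2 := ((ih.mul_left ((n : ℂ) + 1)).sub (h1.mul_left (α - γ))).mul_left
      ((γ - α + n + 1) * (α + n))⁻¹
    convert! h2 using 1
    · funext k
      have h3 := mul_gaussTerm_add_one_left (α + n) β (γ + n + 1) k
      have h4 := add_nat_ne_zero hα k
      rw [gaussTerm_eq_add_one (α + n) β (γ + n) k]
      push_cast
      rw [← add_assoc, ← add_assoc]
      field_simp
      linear_combination (γ - α + n + 1) * h3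
    · rw [Finset.sum_range_succ _ (n + 1)]
      generalize ∑ k ∈ Finset.range (n + 1), Gamma (α - 1 + k) * Gamma (γ - α + k) *
          (k.factorial * Gamma (γ - β + k))⁻¹ = T
      rw [eσ, show γ + n + 1 - (α + n) = γ - α + 1 by ring, Complex.Gamma_add_one _ hγ0,
        Nat.factorial_succ]
      push_cast
      rw [show α - 1 + ((n : ℂ) + 1) = α + n by ring,
        show γ - β + ((n : ℂ) + 1) = γ + n + 1 - β by ring]
      simp only [← add_assoc]
      have g1 := Gamma_ne_zero_of_not_isGammaPole (not_isGammaPole_add_nat hα' n)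
      have g2 := Gamma_ne_zero_of_not_isGammaPole
        (not_isGammaPole_add_one (not_isGammaPole_add_nat hγ n))
      have hn! : (n.factorial : ℂ) ≠ 0 := Nat.cast_ne_zero.2 n.factorial_ne_zero
      have hn1 : (n : ℂ) + 1 ≠ 0 := Nat.cast_add_one_ne_zero n
      rw [Complex.Gamma_add_one _ hαn, Complex.Gamma_add_one _ hγn]
      simp only [mul_inv]
      -- This argument may be a pole of Γ, so its reciprocal is kept as an atom and not cleared as a
      -- denominator.
      generalize (Gamma (γ + n + 1 - β))⁻¹ = G
      field_simp
      ring

/-- Reduces two linear denominators to one, at the cost of a Gauss series; raising β to β + 1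
inserts the weight β + k. -/
lemma hasSum_gaussTerm_div_mul {α β γ S : ℂ} {n : ℕ} (hα : ¬ IsGammaPole (α - 1))
    (hσ : ¬ IsGammaPole (γ + 1 - α - β)) (h : 0 < (γ + 1 - α - β).re ∨ IsGammaPole (β + 1))
    (hS : HasSum (fun k => gaussTerm (α + n) β (γ + n) k * (α - 1 + k)⁻¹) S) :
    HasSum (fun k => n * β * (gaussTerm (α + n) (β + 1) (γ + n) k *
        ((α - 1 + k)⁻¹ * (α + k)⁻¹)))
      ((n * (β + 1 - α) + (α - 1) * (γ + n - α)) * S + (α - γ) * (Gamma (γ + 1 - α - β) *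
        ((Gamma (γ - α + 1))⁻¹ * (Gamma (γ + n - β))⁻¹))) := by
  have hα' : ¬ IsGammaPole α := by simpa using not_isGammaPole_add_one hα
  have han : ¬ IsGammaPole (α - 1 + n) := not_isGammaPole_add_nat hα n
  have hβ : 0 < (γ + 1 - α - β).re ∨ IsGammaPole β :=
    h.imp_right fun h => by simpa using isGammaPole_sub_one h
  have e1 : γ + n - (α - 1 + n) - β = γ + 1 - α - β := by ring
  have hm := hasSum_gaussTerm (a := α - 1 + n) (b := β) (c := γ + n) (by rwa [e1]) (by rwa [e1])
  rw [e1, show γ + n - (α - 1 + n) = γ - α + 1 by ring] at hm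
  have hsum : Summable (fun k => n * β * (gaussTerm (α + n) (β + 1) (γ + n) k *
        ((α - 1 + k)⁻¹ * (α + k)⁻¹))) := by
    obtain ⟨e, L, hL, he⟩ := exists_powerGrowth_rising (b := β + 1) (τ := γ + 2 - α)
      (h.imp_left fun h => by
        rwa [show γ + 2 - α - (β + 1) = γ + 1 - α - β by ring])
    refine Summable.mul_left _ (((powerGrowth_gaussTerm (α + n) (γ + n) hL).mul
      ((PowerGrowth.inv_add_natCast (α - 1)).mul (.inv_add_natCast α))).summable ?_)
    simp only [sub_re, add_re, neg_re, one_re, re_ofNat] at he ⊢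
    linarith
  -- The factor γ + n - 1 + k becomes γ + n + k after the shift and, together with k + 1, turns term
  -- k + 1 into a multiple of term k. The denominators are those of the divided series and of the
  -- Gauss series with top parameter α - 1 + n.
  set H : ℕ → ℂ := fun k => -n * (gaussTerm (α + n) β (γ + n) k * (k * (γ + n - 1 + k)) *
    ((α - 1 + k)⁻¹ * (α - 1 + n + k)⁻¹)) with hH
  have hlim : Tendsto H atTop (𝓝 0) := by
    obtain ⟨e, L, hL, he⟩ := exists_powerGrowth_rising (b := β) (τ := γ + 1 - α) hβ
    refine ((PowerGrowth.const (-n : ℂ)).mul (((powerGrowth_gaussTerm (α + n) (γ + n) hL).mul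
      (PowerGrowth.natCast.mul (.add_natCast (γ + n - 1)))).mul
      ((PowerGrowth.inv_add_natCast (α - 1)).mul
        (.inv_add_natCast (α - 1 + n))))).tendsto_zero ?_
    simp only [sub_re, add_re, neg_re, one_re, zero_re] at he ⊢
    linarith
  have key := hasSum_of_telescoping hsum
    ((hS.mul_left (n * (β + 1 - α) + (α - 1) * (γ + n - α))).add (hm.mul_left (α - γ)))
    (fun k => ?_) hlim
  · simpa [hH] using key
  · have h1 := gaussTerm_succ (α + n) β (γ + n) k
    have h2 := mul_gaussTerm_add_one_left (α - 1 + n) β (γ + n) k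
    have h3 := mul_gaussTerm_add_one_right (α + n) β (γ + n) k
    rw [show α - 1 + n + 1 = α + n by ring] at h2
    have n1 := add_nat_ne_zero hα k
    have n2 := add_nat_ne_zero hα' k
    have n3 := add_nat_ne_zero han k
    have n4 : α + n + k ≠ 0 := by
      simpa using add_nat_ne_zero (not_isGammaPole_add_nat hα' n) k
    have h4 : gaussTerm (α - 1 + n) β (γ + n) k =
        (α - 1 + n) * gaussTerm (α + n) β (γ + n) k * (α - 1 + n + k)⁻¹ := by
      field_simp
      linear_combination -h2
    simp only [hH]
    push_cast
    rw [show gaussTerm (α + n) β (γ + n) (k + 1) * (((k : ℂ) + 1) * (γ + n - 1 + (k + 1))) =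
      (α + n + k) * (β + k) * gaussTerm (α + n) β (γ + n) k by linear_combination h1, h4,
      show α - 1 + ((k : ℂ) + 1) = α + k by ring,
      show α - 1 + n + ((k : ℂ) + 1) = α + n + k by ring,
      show n * β * (gaussTerm (α + n) (β + 1) (γ + n) k * ((α - 1 + k)⁻¹ * (α + k)⁻¹)) =
        n * ((β + k) * gaussTerm (α + n) β (γ + n) k) * ((α - 1 + k)⁻¹ * (α + k)⁻¹) by
        linear_combination n * ((α - 1 + k)⁻¹ * (α + k)⁻¹) * h3]
    generalize gaussTerm (α + n) β (γ + n) k = v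
    field_simp
    ring

/-- The evaluation of `₃F₂(a, a - n - 1, b; c, a - n + 1 | 1)`. -/
lemma hasSum_top_bottom_gap_two {n : ℕ} (hn : 0 < n) {a b c : ℂ} (hb : b ≠ 1)
    (hc : ¬ IsGammaPole c) (ha : ¬ IsGammaPole (a - 1 - n)) (hca : ¬ IsGammaPole (c - a))
    (hσ : ¬ IsGammaPole (-b + 2 + c - a)) (h : 0 < (-b + 2 + c - a).re ∨ IsGammaPole b) :
    HasSum (hyperTerm [a, a - n - 1, b] [c, a - n + 1] 1)
        (-((a - n) * (a - n - 1) *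
              (-b * n - a * c + n * c + a ^ 2 - a * n + c - a + n) *
              Gamma (-b + 2 + c - a) * Gamma c * Gamma n *
              ∑ k ∈ Finset.range (n + 1),
                Gamma (a - 1 - n + k) * Gamma (c - a + k) /
                  (Gamma (k + 1) * Gamma (1 - n + c - b + k))) /
            ((b - 1) * Gamma (n + c + 1 - a) * Gamma (c - a) * Gamma a) -
          (a - n) * (a - n - 1) * Gamma (-b + 2 + c - a) * Gamma c /
            (n * (b - 1) * Gamma (c + 1 - b) * Gamma (c - a))) := by
  obtain ⟨α, rfl⟩ : ∃ α, a = α + n := ⟨a - n, by ring⟩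
  obtain ⟨γ, rfl⟩ : ∃ γ, c = γ + n := ⟨c - n, by ring⟩
  obtain ⟨β, rfl⟩ : ∃ β, b = β + 1 := ⟨b - 1, by ring⟩
  have e1 : α + n - 1 - n = α - 1 := by ring
  have e2 : γ + n - (α + n) = γ - α := by ring
  have e3 : -(β + 1) + 2 + (γ + n) - (α + n) = γ + 1 - α - β := by ring
  have e4 : α + n - n = α := by ring
  have e5 : 1 - n + (γ + n) - (β + 1) = γ - β := by ring
  have e6 : n + (γ + n) + 1 - (α + n) = γ - α + n + 1 := by ring
  have e7 : γ + n + 1 - (β + 1) = γ + n - β := by ring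
  rw [e1] at ha
  rw [e2] at hca
  rw [e3] at hσ h
  simp only [e1, e2, e3, e4, e5, e6, e7]
  have hβ : β ≠ 0 := fun h => hb (by simp [h])
  have hn0 : (n : ℂ) ≠ 0 := Nat.cast_ne_zero.2 hn.ne'
  have hX := hasSum_gaussTerm_div ha hca hσ
    (h.imp_right fun h => by simpa using isGammaPole_sub_one h) n
  -- The quotient of the rising factorials of α - 1 and α + 1 is α (α - 1) / ((α - 1 + k)(α + k)),
  -- which turns the ₃F₂ into the doubly divided Gauss series.
  have key := (hasSum_gaussTerm_div_mul ha hσ h hX).mul_left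
    (Gamma (γ + n) * (α * (α - 1)) * (n * β)⁻¹)
  convert! key using 1
  · funext k
    have h1 := rising_mul_inv_rising_add_two ha k
    rw [sub_add_cancel, show α - 1 + 2 = α + 1 by ring] at h1
    rw [hyperTerm_three_two, inv_rising_eq hc, gaussTerm]
    have h2 : ((n : ℂ) * β)⁻¹ * (n * β) = 1 := inv_mul_cancel₀ (mul_ne_zero hn0 hβ)
    linear_combination rising (α + n) k * rising (β + 1) k * (k.factorial : ℂ)⁻¹ *
      (Gamma (γ + n) * (Gamma (γ + n + k))⁻¹) * (h1 - α * (α - 1) *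
        ((α - 1 + k)⁻¹ * (α + k)⁻¹) * h2)
  · have hγ0 := ne_zero_of_not_isGammaPole hca
    have hG := Gamma_ne_zero_of_not_isGammaPole hca
    have eS : ∀ k : ℕ, Gamma (α - 1 + k) * Gamma (γ - α + k) /
        (Gamma (k + 1) * Gamma (γ - β + k)) =
        Gamma (α - 1 + k) * Gamma (γ - α + k) * (k.factorial * Gamma (γ - β + k))⁻¹ :=
      fun k => by rw [Gamma_nat_eq_factorial, div_eq_mul_inv]
    simp only [eS]
    generalize ∑ k ∈ Finset.range (n + 1), Gamma (α - 1 + k) * Gamma (γ - α + k) *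
        (k.factorial * Gamma (γ - β + k))⁻¹ = T
    obtain ⟨N, rfl⟩ : ∃ N, n = N + 1 := ⟨n - 1, by omega⟩
    rw [Complex.Gamma_add_one _ hγ0, Nat.factorial_succ]
    have eN : Gamma ((N + 1 : ℕ) : ℂ) = N.factorial := by
      rw [Nat.cast_succ, Gamma_nat_eq_factorial]
    rw [eN, add_sub_cancel_right, Nat.cast_mul]
    simp only [div_eq_mul_inv, mul_inv]
    generalize ((N + 1 : ℕ) : ℂ) = n at *
    generalize (Gamma (γ + n - β))⁻¹ = G₁
    generalize (Gamma (γ - α + n + 1))⁻¹ = G₂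
    generalize (Gamma (α + n))⁻¹ = G₃
    field_simp
    ring

/-! ### Differences of Gauss series divided by f + n + k -/

lemma gaussTerm_comm (a b c : ℂ) : gaussTerm a b c = gaussTerm b a c := by
  funext k
  rw [gaussTerm, gaussTerm, mul_comm (rising a k)]

/-- The closed form of `∑ (b)_k (c)_k / (Γ(f + k) k! (f + n + k))` as a partial sum of a Gauss
series, continued analytically to all `b`, `c` and `f`. -/
def stieltjesGauss (b c f : ℂ) (n : ℕ) : ℂ :=
  Gamma (f + 1 - b - c) * n.factorial * Gamma (f + n) *
    (Gamma (f - b) * Gamma (f - c) * Gamma (f - b + n + 1) * Gamma (f - c + n + 1))⁻¹ *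
    ∑ k ∈ Finset.range (n + 1),
      Gamma (f - c + k) * Gamma (f - b + k) * (k.factorial * Gamma (f + k))⁻¹

lemma stieltjesGauss_comm (b c f : ℂ) (n : ℕ) :
    stieltjesGauss b c f n = stieltjesGauss c b f n := by
  simp only [stieltjesGauss, mul_comm (Gamma (f - c + _)) (Gamma (f - b + _))]
  rw [sub_right_comm]
  ring

lemma stieltjesGauss_zero {b c f : ℂ} (hf : ¬ IsGammaPole f) (hfb : ¬ IsGammaPole (f - b))
    (hfc : ¬ IsGammaPole (f - c)) :
    stieltjesGauss b c f 0 =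
      Gamma (f + 1 - b - c) * (Gamma (f - b + 1) * Gamma (f - c + 1))⁻¹ := by
  have h1 := Gamma_ne_zero_of_not_isGammaPole hf
  have h2 := Gamma_ne_zero_of_not_isGammaPole hfb
  have h3 := Gamma_ne_zero_of_not_isGammaPole hfc
  simp only [stieltjesGauss, Nat.cast_zero, add_zero, zero_add, Finset.sum_range_one,
    Nat.factorial_zero, Nat.cast_one, one_mul, mul_one]
  field_simp

/-- The inhomogeneous term is the summand by which the partial sum grows; the prefactors account for
the rest. -/
lemma stieltjesGauss_succ {b c f : ℂ} (hf : ¬ IsGammaPole f) (hfb : ¬ IsGammaPole (f - b))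
    (hfc : ¬ IsGammaPole (f - c)) (n : ℕ) :
    (f - b + n + 1) * (f - c + n + 1) * stieltjesGauss b c f (n + 1) =
      (f + n) * (n + 1) * stieltjesGauss b c f n +
        Gamma (f + 1 - b - c) * (Gamma (f - b) * Gamma (f - c))⁻¹ := by
  have h1 := Gamma_ne_zero_of_not_isGammaPole hfb
  have h2 := Gamma_ne_zero_of_not_isGammaPole hfc
  have h3 := Gamma_ne_zero_of_not_isGammaPole (not_isGammaPole_add_nat hf n)
  have h4 := Gamma_ne_zero_of_not_isGammaPole
    (not_isGammaPole_add_one (not_isGammaPole_add_nat hfb n))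
  have h5 := Gamma_ne_zero_of_not_isGammaPole
    (not_isGammaPole_add_one (not_isGammaPole_add_nat hfc n))
  have n1 := add_nat_ne_zero hf n
  have n2 : f - b + n + 1 ≠ 0 := by simpa [add_assoc] using add_nat_ne_zero hfb (n + 1)
  have n3 : f - c + n + 1 ≠ 0 := by simpa [add_assoc] using add_nat_ne_zero hfc (n + 1)
  have hn! : (n.factorial : ℂ) ≠ 0 := Nat.cast_ne_zero.2 n.factorial_ne_zero
  have hn1 : (n : ℂ) + 1 ≠ 0 := Nat.cast_add_one_ne_zero n
  rw [stieltjesGauss, stieltjesGauss, Finset.sum_range_succ _ (n + 1)]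
  generalize ∑ k ∈ Finset.range (n + 1),
      Gamma (f - c + k) * Gamma (f - b + k) * (k.factorial * Gamma (f + k))⁻¹ = T
  rw [Nat.factorial_succ]
  push_cast
  simp only [← add_assoc]
  rw [Complex.Gamma_add_one _ n1, Complex.Gamma_add_one _ n2, Complex.Gamma_add_one _ n3]
  field_simp

/-- A single divided series is available directly only for Re(f + 1 - b - c) > 0 or when it
terminates. Subtracting it from the one with n = 0 gains one power of `k`: 1/(f + k) - 1/(f + n + k)
= n/((f + k)(f + n + k)). Hence only differences of the continued closed form appear. -/
lemma hasSum_stieltjesGauss_aux {b c f : ℂ} (hf : ¬ IsGammaPole f)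
    (hfb : ¬ IsGammaPole (f - b)) (hfc : ¬ IsGammaPole (f - c))
    (hs : ¬ IsGammaPole (f + 1 - b - c)) (h : 0 < (f + 2 - b - c).re ∨ IsGammaPole c) (n : ℕ) :
    HasSum (fun k => n * (gaussTerm b c (f + 2) k * (f + 1 + k) * (f + n + k)⁻¹))
      (stieltjesGauss b c f 0 - stieltjesGauss b c f n) := by
  have hs' : ¬ IsGammaPole (f + 2 - b - c) := by
    rw [show f + 2 - b - c = f + 1 - b - c + 1 by ring]
    exact not_isGammaPole_add_one hs
  have hM := hasSum_gaussTerm hs' h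
  obtain ⟨e, L, hL, he⟩ := exists_powerGrowth_rising h
  have hq := powerGrowth_gaussTerm b (f + 2) hL
  have hsum : ∀ n : ℕ, Summable (fun k => gaussTerm b c (f + 2) k * (f + 1 + k) *
      (f + n + k)⁻¹) := by
    intro n
    refine ((hq.mul (.add_natCast (f + 1))).mul (.inv_add_natCast (f + n))).summable ?_
    simp only [sub_re, add_re, neg_re, one_re, re_ofNat] at he ⊢
    linarith
  induction n with
  | zero => simp [hasSum_zero]
  | succ n ih =>
    have n1 := ne_zero_of_not_isGammaPole (not_isGammaPole_add_one (not_isGammaPole_add_nat hfb n))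
    have n2 := ne_zero_of_not_isGammaPole (not_isGammaPole_add_one (not_isGammaPole_add_nat hfc n))
    have n3 := ne_zero_of_not_isGammaPole hfb
    have n4 := ne_zero_of_not_isGammaPole hfc
    have n5 := ne_zero_of_not_isGammaPole (not_isGammaPole_add_one hfb)
    have n6 := ne_zero_of_not_isGammaPole (not_isGammaPole_add_one hfc)
    set H : ℕ → ℂ := fun k => -(n + 1) * n * (gaussTerm b c (f + 2) k * (k * (f + 1 + k)) *
      (f + n + k)⁻¹) with hH
    have hlim : Tendsto H atTop (𝓝 0) := by
      refine ((PowerGrowth.const (-(n + 1) * n : ℂ)).mul ((hq.mul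
        (PowerGrowth.natCast.mul (.add_natCast (f + 1)))).mul
        (.inv_add_natCast (f + n)))).tendsto_zero ?_
      simp only [sub_re, add_re, neg_re, one_re, zero_re, re_ofNat] at he ⊢
      linarith
    have key := hasSum_of_telescoping
      (((hsum (n + 1)).mul_left ((n + 1 : ℕ) : ℂ)).mul_left ((f - b + n + 1) * (f - c + n + 1)))
      ((ih.mul_left ((n + 1) * (f + n))).add
        (hM.mul_left ((n + 1) * (f - b + 1) * (f - c + 1)))) (fun k => ?_) hlim
    · convert! key.mul_left ((f - b + n + 1) * (f - c + n + 1))⁻¹ using 1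
      · funext k
        rw [inv_mul_cancel_left₀ (mul_ne_zero n1 n2)]
      -- Both the Gauss value and the inhomogeneous term are multiples of the closed form at n = 0,
      -- so the two recurrences can be compared directly.
      · have h1 := stieltjesGauss_succ hf hfb hfc n
        have h2 := stieltjesGauss_zero hf hfb hfc
        have e1 : Gamma (f + 2 - b - c) = (f + 1 - b - c) * Gamma (f + 1 - b - c) := by
          rw [← Complex.Gamma_add_one _ (ne_zero_of_not_isGammaPole hs)]
          ring_nf
        have e2 : (f - b + 1) * (Gamma (f + 2 - b))⁻¹ = (Gamma (f - b + 1))⁻¹ := by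
          rw [inv_Gamma_eq (f - b + 1)]
          ring_nf
        have e3 : (f - c + 1) * (Gamma (f + 2 - c))⁻¹ = (Gamma (f - c + 1))⁻¹ := by
          rw [inv_Gamma_eq (f - c + 1)]
          ring_nf
        have e4 : (n + 1) * (f - b + 1) * (f - c + 1) * (Gamma (f + 2 - b - c) *
            ((Gamma (f + 2 - b))⁻¹ * (Gamma (f + 2 - c))⁻¹)) =
            (n + 1) * (f + 1 - b - c) * stieltjesGauss b c f 0 := by
          rw [h2, mul_inv, ← e2, ← e3, e1]
          ring
        have e5 : Gamma (f + 1 - b - c) * (Gamma (f - b) * Gamma (f - c))⁻¹ =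
            (f - b) * (f - c) * stieltjesGauss b c f 0 := by
          rw [h2, mul_inv, mul_inv, inv_Gamma_eq (f - b), inv_Gamma_eq (f - c)]
          ring
        rw [e5] at h1
        rw [e4, eq_inv_mul_iff_mul_eq₀ (mul_ne_zero n1 n2)]
        simp only [hH, Nat.cast_zero, zero_mul, mul_zero]
        linear_combination -h1
    · have h1 := gaussTerm_succ b c (f + 2) k
      have m1 := add_nat_ne_zero (not_isGammaPole_add_nat hf n) k
      have m2 := add_nat_ne_zero (not_isGammaPole_add_one (not_isGammaPole_add_nat hf n)) k
      simp only [hH]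
      push_cast
      rw [show gaussTerm b c (f + 2) (k + 1) * (((k : ℂ) + 1) * (f + 1 + (k + 1))) =
        (b + k) * (c + k) * gaussTerm b c (f + 2) k by linear_combination h1,
        show f + n + ((k : ℂ) + 1) = f + n + 1 + k by ring, ← add_assoc]
      generalize gaussTerm b c (f + 2) k = v
      field_simp
      ring

lemma hasSum_stieltjesGauss {b c f : ℂ} (hf : ¬ IsGammaPole f)
    (hfb : ¬ IsGammaPole (f - b)) (hfc : ¬ IsGammaPole (f - c))
    (hs : ¬ IsGammaPole (f + 1 - b - c))
    (h : 0 < (f + 2 - b - c).re ∨ IsGammaPole b ∨ IsGammaPole c) (n : ℕ) :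
    HasSum (fun k => n * (gaussTerm b c (f + 2) k * (f + 1 + k) * (f + n + k)⁻¹))
      (stieltjesGauss b c f 0 - stieltjesGauss b c f n) := by
  by_cases hb : IsGammaPole b
  · rw [gaussTerm_comm, stieltjesGauss_comm b, stieltjesGauss_comm b]
    exact hasSum_stieltjesGauss_aux hf hfc hfb (by rwa [sub_right_comm]) (Or.inr hb) n
  · exact hasSum_stieltjesGauss_aux hf hfb hfc hs (h.imp_right (Or.resolve_left · hb)) n

/-- The evaluation of `₃F₂(a, b, c; a + 2, a - n + 1 | 1)`. -/
lemma hasSum_bottom_gap_two {n : ℕ} (hn : 0 < n) {a b c : ℂ}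
    (hf : ¬ IsGammaPole (a - n + 1)) (hs : ¬ IsGammaPole (a + 2 - b - c - n))
    (hfc : ¬ IsGammaPole (a + 1 - n - c)) (hfb : ¬ IsGammaPole (-b - n + 1 + a))
    (h : 0 < (a - b - c - n + 3).re ∨ IsGammaPole b ∨ IsGammaPole c) :
    HasSum (hyperTerm [a, b, c] [2 + a, a - n + 1] 1)
        ((n * c * b - n * c - a * n * c - a * n * b + n + 2 * a * n - b * n
                - (n : ℂ) ^ 2 * a + n * a ^ 2) *
            Gamma (2 + a) * Gamma (a + 2 - b - c - n) * Gamma (a - n + 1) * Gamma n *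
            (∑ k ∈ Finset.range (n + 1),
              Gamma (a + k + 1 - n - c) * Gamma (-b - n + 1 + a + k) /
                (Gamma (k + 1) * Gamma (a + 1 + k - n))) /
            (n * Gamma (-b - n + 1 + a) * Gamma (2 + a - b) * Gamma (2 + a - c) *
              Gamma (1 + a - c - n)) +
          Gamma (a + 2 - b - c - n) * (-1 - a) * Gamma (a - n + 1) /
            (Gamma (-b - n + 1 + a) * n * Gamma (1 + a - c - n))) := by
  obtain ⟨N, rfl⟩ : ∃ N, n = N + 1 := ⟨n - 1, by omega⟩
  obtain ⟨f, rfl⟩ : ∃ f, a = f + N := ⟨a - N, by ring⟩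
  have e1 : f + N - ((N + 1 : ℕ) : ℂ) + 1 = f := by push_cast; ring
  have e2 : f + N + 2 - b - c - ((N + 1 : ℕ) : ℂ) = f + 1 - b - c := by push_cast; ring
  have e3 : f + N + 1 - ((N + 1 : ℕ) : ℂ) - c = f - c := by push_cast; ring
  have e4 : -b - ((N + 1 : ℕ) : ℂ) + 1 + (f + N) = f - b := by push_cast; ring
  have e5 : f + N - b - c - ((N + 1 : ℕ) : ℂ) + 3 = f + 2 - b - c := by push_cast; ring
  have e6 : 1 + (f + N) - c - ((N + 1 : ℕ) : ℂ) = f - c := by push_cast; ring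
  have e7 : 2 + (f + N) - b = f - b + N + 1 + 1 := by ring
  have e8 : 2 + (f + N) - c = f - c + N + 1 + 1 := by ring
  have e9 : 2 + (f + N) = f + N + 1 + 1 := by ring
  rw [e1] at hf
  rw [e2] at hs
  rw [e3] at hfc
  rw [e4] at hfb
  rw [e5] at h
  have eS : ∀ k : ℕ, Gamma (f + N + k + 1 - ((N + 1 : ℕ) : ℂ) - c) *
      Gamma (-b - ((N + 1 : ℕ) : ℂ) + 1 + (f + N) + k) /
        (Gamma (k + 1) * Gamma (f + N + 1 + k - ((N + 1 : ℕ) : ℂ))) =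
      Gamma (f - c + k) * Gamma (f - b + k) * (k.factorial * Gamma (f + k))⁻¹ := by
    intro k
    rw [Gamma_nat_eq_factorial, div_eq_mul_inv, e4,
      show f + N + k + 1 - ((N + 1 : ℕ) : ℂ) - c = f - c + k by push_cast; ring,
      show f + N + 1 + k - ((N + 1 : ℕ) : ℂ) = f + k by push_cast; ring]
  simp only [eS]
  simp only [e1, e2, e4, e6, e7, e8]
  have hfN := not_isGammaPole_add_nat hf N
  have n1 := ne_zero_of_not_isGammaPole hfN
  have n2 := ne_zero_of_not_isGammaPole (not_isGammaPole_add_one hfN)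
  -- With n = N + 1 the ratio of rising factorials splits into 1/(f + N + k) - 1/(f + N + 1 + k);
  -- the contributions of index 0 cancel.
  have key := ((hasSum_stieltjesGauss hf hfb hfc hs h (N + 1)).sub
    (hasSum_stieltjesGauss hf hfb hfc hs h N)).mul_left
    (Gamma f * ((f + N) * (f + N + 1)))
  convert! key using 1
  · funext k
    have h1 := rising_mul_inv_rising_add_two hfN k
    have m1 := add_nat_ne_zero hfN k
    have m2 := add_nat_ne_zero (not_isGammaPole_add_one hfN) k
    have h2 : gaussTerm b c f k = (f + k) * ((f + 1 + k) * gaussTerm b c (f + 2) k) := by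
      rw [gaussTerm_eq_add_one, gaussTerm_eq_add_one, show f + 1 + 1 = f + 2 by ring]
    have h3 : hyperTerm [f + N, b, c] [2 + (f + N), f] 1 k =
        rising (f + N) k * (rising (f + N + 2) k)⁻¹ * (Gamma f * gaussTerm b c f k) := by
      rw [hyperTerm_three_two, inv_rising_eq hf, gaussTerm, add_comm 2 (f + (N : ℂ))]
      ring
    rw [h3, h1, h2]
    push_cast
    rw [← add_assoc]
    generalize gaussTerm b c (f + 2) k = v
    field_simp
    ring
  · have hN1 : (N : ℂ) + 1 ≠ 0 := Nat.cast_add_one_ne_zero N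
    have hN! : (N.factorial : ℂ) ≠ 0 := Nat.cast_ne_zero.2 N.factorial_ne_zero
    have h1 := Gamma_ne_zero_of_not_isGammaPole hfb
    have h2 := Gamma_ne_zero_of_not_isGammaPole hfc
    have h3 := Gamma_ne_zero_of_not_isGammaPole hfN
    have h4 := Gamma_ne_zero_of_not_isGammaPole
      (not_isGammaPole_add_one (not_isGammaPole_add_nat hfb N))
    have h5 := Gamma_ne_zero_of_not_isGammaPole
      (not_isGammaPole_add_one (not_isGammaPole_add_nat hfc N))
    have n3 := ne_zero_of_not_isGammaPole
      (not_isGammaPole_add_one (not_isGammaPole_add_nat hfb N))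
    have n4 := ne_zero_of_not_isGammaPole
      (not_isGammaPole_add_one (not_isGammaPole_add_nat hfc N))
    have eN : Gamma ((N + 1 : ℕ) : ℂ) = N.factorial := by
      rw [Nat.cast_succ, Gamma_nat_eq_factorial]
    have hrec := stieltjesGauss_succ hf hfb hfc N
    -- Eliminating the value at `N` leaves the sum up to n with coefficient (a + 1 - b)(a + 1 - c) -
    -- a n, which is the quadratic polynomial of the statement divided by n; the inhomogeneous term
    -- becomes the second summand.
    have hN : stieltjesGauss b c f N = ((f - b + N + 1) * (f - c + N + 1) *
        stieltjesGauss b c f (N + 1) - Gamma (f + 1 - b - c) *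
        (Gamma (f - b) * Gamma (f - c))⁻¹) * ((f + N) * (N + 1))⁻¹ := by
      field_simp at hrec ⊢
      linear_combination -hrec
    rw [sub_sub_sub_cancel_left, hN, stieltjesGauss, eN, e9]
    generalize ∑ k ∈ Finset.range (N + 1 + 1),
      Gamma (f - c + k) * Gamma (f - b + k) * (k.factorial * Gamma (f + k))⁻¹ = T
    rw [Nat.factorial_succ]
    push_cast
    simp only [← add_assoc]
    rw [Complex.Gamma_add_one _ n2, Complex.Gamma_add_one _ n1, Complex.Gamma_add_one _ n3,
      Complex.Gamma_add_one _ n4]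
    field_simp
    ring

/-! ### Infinite series with top parameter 1, then 2 -/

/-- The rising factorial of 1 cancels k!, so the factor k + 1 drops out of the ratio. Certificates
then need no factor `k`, and their value at k = 0 supplies the inhomogeneous terms below. -/
lemma threeTwoTerm_one_succ (b c d e : ℂ) (k : ℕ) :
    (d + k) * (e + k) * threeTwoTerm 1 b c d e (k + 1) =
      (b + k) * (c + k) * threeTwoTerm 1 b c d e k := by
  refine mul_left_cancel₀ (Nat.cast_add_one_ne_zero (R := ℂ) k) ?_
  linear_combination threeTwoTerm_succ 1 b c d e k

lemma threeTwoTerm_apply_zero (a b c d e : ℂ) :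
    threeTwoTerm a b c d e 0 = (Gamma d)⁻¹ * (Gamma e)⁻¹ := by
  simp [threeTwoTerm, rising_zero]

lemma summable_threeTwoTerm_one {α b γ : ℂ} (h : 0 < (γ - 1 - b).re ∨ IsGammaPole b) (n : ℕ) :
    Summable (threeTwoTerm 1 b (α + n) (α + 1) (γ + n)) := by
  obtain ⟨ε, L, hL, hε⟩ := exists_powerGrowth_rising h
  refine (powerGrowth_threeTwoTerm_of_powerGrowth 1 (α + n) (α + 1) (γ + n) hL).summable ?_
  simp only [sub_re, add_re, one_re] at hε ⊢
  linarith

lemma hasSum_threeTwoTerm_one_succ {α b γ S : ℂ} {n : ℕ}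
    (h : 0 < (γ - 1 - b).re ∨ IsGammaPole b)
    (hS : HasSum (threeTwoTerm 1 b (α + n) (α + 1) (γ + n)) S) :
    HasSum (fun k => (γ - b + n) * (α + n) *
        threeTwoTerm 1 b (α + (n + 1 : ℕ)) (α + 1) (γ + (n + 1 : ℕ)) k)
      (n * S + (Gamma α)⁻¹ * (Gamma (γ + n))⁻¹) := by
  set H : ℕ → ℂ := fun k => -1 * ((α + k) * (γ + n + k) *
    threeTwoTerm 1 b (α + n) (α + 1) (γ + n + 1) k) with hH
  have hlim : Tendsto H atTop (𝓝 0) := by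
    obtain ⟨ε, L, hL, hε⟩ := exists_powerGrowth_rising h
    refine ((PowerGrowth.const (-1)).mul (((PowerGrowth.add_natCast α).mul
      (.add_natCast (γ + n))).mul (powerGrowth_threeTwoTerm_of_powerGrowth 1 (α + n) (α + 1)
      (γ + n + 1) hL))).tendsto_zero ?_
    simp only [sub_re, add_re, one_re, zero_re] at hε ⊢
    linarith
  have key := hasSum_of_telescoping ((summable_threeTwoTerm_one (α := α) h (n + 1)).mul_left
    ((γ - b + n) * (α + n))) (hS.mul_left (n : ℂ)) (fun k => ?_) hlim
  · convert! key using 1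
    rw [hH, inv_Gamma_eq α, inv_Gamma_eq (γ + n)]
    simp only [threeTwoTerm_apply_zero, Nat.cast_zero]
    ring
  · have h1 := threeTwoTerm_one_succ b (α + n) (α + 1) (γ + n + 1) k
    have h2 := mul_threeTwoTerm_add_one_top 1 b (α + n) (α + 1) (γ + n + 1) k
    have h3 := threeTwoTerm_eq_add_one_bottom 1 b (α + n) (α + 1) (γ + n) k
    simp only [hH]
    rw [h3]
    push_cast
    simp only [← add_assoc]
    linear_combination (γ - b + n) * h2 + h1

lemma hasSum_threeTwoTerm_one {α b γ : ℂ} (hα : ¬ IsGammaPole α) (hγ : ¬ IsGammaPole (γ - b))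
    (h : 0 < (γ - 1 - b).re ∨ IsGammaPole b) (n : ℕ) :
    HasSum (threeTwoTerm 1 b (α + (n + 1 : ℕ)) (α + 1) (γ + (n + 1 : ℕ)))
      (n.factorial * (Gamma (γ - b + n + 1) * Gamma (α + n + 1) * Gamma α)⁻¹ *
        ∑ m ∈ Finset.range (n + 1),
          Gamma (γ - b + m) * Gamma (α + m) * (m.factorial * Gamma (γ + m))⁻¹) := by
  have hαG := Gamma_ne_zero_of_not_isGammaPole hα
  have step : ∀ n : ℕ, ∀ S : ℂ, HasSum (threeTwoTerm 1 b (α + n) (α + 1) (γ + n)) S →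
      HasSum (threeTwoTerm 1 b (α + (n + 1 : ℕ)) (α + 1) (γ + (n + 1 : ℕ)))
        (((γ - b + n) * (α + n))⁻¹ * (n * S + (Gamma α)⁻¹ * (Gamma (γ + n))⁻¹)) := by
    intro n S hS
    have h1 := mul_ne_zero (add_nat_ne_zero hγ n) (add_nat_ne_zero hα n)
    convert! (hasSum_threeTwoTerm_one_succ h hS).mul_left ((γ - b + n) * (α + n))⁻¹ using 1
    funext k
    rw [inv_mul_cancel_left₀ h1]
  induction n with
  | zero =>
    -- The unknown sum at index 0 is multiplied by n = 0, so its value is not needed.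
    convert! step 0 _ (summable_threeTwoTerm_one h 0).hasSum using 1
    have h1 := Gamma_ne_zero_of_not_isGammaPole hγ
    have h2 := ne_zero_of_not_isGammaPole hα
    have h3 := ne_zero_of_not_isGammaPole hγ
    simp only [Nat.cast_zero, add_zero, zero_add, Finset.sum_range_one, Nat.factorial_zero,
      Nat.cast_one, one_mul, zero_mul, Complex.Gamma_add_one _ h2, Complex.Gamma_add_one _ h3]
    field_simp
  | succ n ih =>
    convert! step (n + 1) _ ih using 1
    have g1 := Gamma_ne_zero_of_not_isGammaPole
      (not_isGammaPole_add_one (not_isGammaPole_add_nat hα n))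
    have g2 := Gamma_ne_zero_of_not_isGammaPole
      (not_isGammaPole_add_one (not_isGammaPole_add_nat hγ n))
    have n1 := ne_zero_of_not_isGammaPole (not_isGammaPole_add_one (not_isGammaPole_add_nat hα n))
    have n2 := ne_zero_of_not_isGammaPole (not_isGammaPole_add_one (not_isGammaPole_add_nat hγ n))
    have hn! : (n.factorial : ℂ) ≠ 0 := Nat.cast_ne_zero.2 n.factorial_ne_zero
    have hn1 : (n : ℂ) + 1 ≠ 0 := Nat.cast_add_one_ne_zero n
    rw [Finset.sum_range_succ _ (n + 1)]
    generalize ∑ m ∈ Finset.range (n + 1),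
          Gamma (γ - b + m) * Gamma (α + m) * (m.factorial * Gamma (γ + m))⁻¹ = T
    rw [Nat.factorial_succ]
    push_cast
    simp only [← add_assoc]
    rw [Complex.Gamma_add_one _ n1, Complex.Gamma_add_one _ n2]
    simp only [mul_inv]
    generalize (Gamma (γ + n + 1))⁻¹ = G
    field_simp

/-- Converts the partial sum produced by the recurrence into the one with α, γ lowered by one and
one more term. Solving for the former divides by α - b. -/
lemma sum_Gamma_contiguous {α b γ : ℂ} (hα : ¬ IsGammaPole (α - 1))
    (hγ : ¬ IsGammaPole (γ - 1 - b)) (n : ℕ) :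
    (α - b) * ∑ m ∈ Finset.range n,
        Gamma (γ - b + m) * Gamma (α + m) * (m.factorial * Gamma (γ + m))⁻¹ +
      (α - 1) * (γ - 1 - b) * ∑ m ∈ Finset.range (n + 1),
        Gamma (α - 1 + m) * Gamma (γ - 1 - b + m) * (m.factorial * Gamma (γ - 1 + m))⁻¹ =
      Gamma (α + n) * Gamma (γ - b + n) * (n.factorial * Gamma (γ - 1 + n))⁻¹ := by
  induction n with
  | zero =>
    have h1 := Complex.Gamma_add_one _ (ne_zero_of_not_isGammaPole hα)
    have h2 := Complex.Gamma_add_one _ (ne_zero_of_not_isGammaPole hγ)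
    rw [sub_add_cancel] at h1
    rw [show γ - 1 - b + 1 = γ - b by ring] at h2
    simp [h1, h2]
    ring
  | succ n ih =>
    have hn1 : (n : ℂ) + 1 ≠ 0 := Nat.cast_add_one_ne_zero n
    have hα' : ¬ IsGammaPole α := by simpa using not_isGammaPole_add_one hα
    have hγ' : ¬ IsGammaPole (γ - b) := by
      rw [show γ - b = γ - 1 - b + 1 by ring]
      exact not_isGammaPole_add_one hγ
    have h1 := Complex.Gamma_add_one _ (add_nat_ne_zero hα' n)
    have h2 := Complex.Gamma_add_one _ (add_nat_ne_zero hγ' n)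
    have h3 := inv_Gamma_eq (γ - 1 + n)
    rw [show γ - 1 + n + 1 = γ + n by ring] at h3
    rw [Finset.sum_range_succ, Finset.sum_range_succ _ (n + 1), mul_add, mul_add,
      add_add_add_comm, ih, Nat.factorial_succ]
    push_cast
    rw [show α - 1 + ((n : ℂ) + 1) = α + n by ring,
      show γ - 1 - b + ((n : ℂ) + 1) = γ - b + n by ring,
      show γ - 1 + ((n : ℂ) + 1) = γ + n by ring, ← add_assoc, ← add_assoc α,
      ← add_assoc (γ - b), h1, h2]
    simp only [mul_inv]
    rw [h3]
    generalize (Gamma (γ + n))⁻¹ = G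
    have hn! : (n.factorial : ℂ) ≠ 0 := Nat.cast_ne_zero.2 n.factorial_ne_zero
    field_simp
    ring

/-- Passes from top parameter 1 to 2, since the rising factorial of 2 is (k + 1) k!. -/
lemma hasSum_mul_threeTwoTerm_one {α b γ S : ℂ} {n : ℕ}
    (h : 0 < (γ - 1 - b).re ∨ IsGammaPole b)
    (hS : HasSum (threeTwoTerm 1 b (α + n) (α + 1) (γ + n)) S) :
    HasSum (fun k : ℕ => (b - γ + 1) *
        ((k + 1) * threeTwoTerm 1 b (α + n) (α + 1) (γ + n) k))
      ((b - γ + 1 - (α + n) * b + α * (γ + n - 1)) * S -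
        α * (γ + n - 1) * ((Gamma (α + 1))⁻¹ * (Gamma (γ + n))⁻¹)) := by
  obtain ⟨ε, L, hL, hε⟩ := exists_powerGrowth_rising h
  have hg := powerGrowth_threeTwoTerm_of_powerGrowth 1 (α + n) (α + 1) (γ + n) hL
  have hsum : Summable fun k : ℕ =>
      ((k : ℂ) + 1) * threeTwoTerm 1 b (α + n) (α + 1) (γ + n) k := by
    refine (((PowerGrowth.add_natCast 1).mul hg).congr
      (fun k => by rw [add_comm (1 : ℂ)]) rfl rfl).summable ?_
    simp only [sub_re, add_re, one_re] at hε ⊢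
    linarith
  set H : ℕ → ℂ := fun k => (α + k) * (γ + n - 1 + k) *
    threeTwoTerm 1 b (α + n) (α + 1) (γ + n) k with hH
  have hlim : Tendsto H atTop (𝓝 0) := by
    refine (((PowerGrowth.add_natCast α).mul
      (.add_natCast (γ + n - 1))).mul hg).tendsto_zero ?_
    simp only [sub_re, add_re, one_re] at hε ⊢
    linarith
  have key := hasSum_of_telescoping (hsum.mul_left (b - γ + 1))
    (hS.mul_left (b - γ + 1 - (α + n) * b + α * (γ + n - 1))) (fun k => ?_) hlim
  · convert! key using 1
    simp only [hH, threeTwoTerm_apply_zero, Nat.cast_zero]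
    ring
  · have h1 := threeTwoTerm_one_succ b (α + n) (α + 1) (γ + n) k
    simp only [hH]
    push_cast
    linear_combination -h1

/-- The evaluation of `₃F₂(a, b, 2; c, a - n + 1 | 1)`. -/
lemma hasSum_top_two {n : ℕ} (hn : 0 < n) {a b c : ℂ} (h0 : a - n - b ≠ 0)
    (hc : ¬ IsGammaPole c) (ha : ¬ IsGammaPole (a - 1 - n)) (hs : ¬ IsGammaPole (c - 1 - n - b))
    (h : 0 < (c - 1 - n - b).re ∨ IsGammaPole b) :
    HasSum (hyperTerm [a, b, 2] [c, a - n + 1] 1)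
        (-((a - n - 1) * (a - n) *
              (a * b - b - 1 - 2 * n + a - a * c + n * c + c) * Gamma c * Gamma n *
              ∑ k ∈ Finset.range (n + 1),
                Gamma (a - 1 - n + k) * Gamma (c - 1 - n - b + k) /
                  (Gamma (k + 1) * Gamma (c - n - 1 + k))) /
            ((a - n - b) * Gamma a * Gamma (c - b)) -
          (a - n - 1) * (a - n) * (c - 1) / (n * (a - n - b))) := by
  obtain ⟨N, rfl⟩ : ∃ N, n = N + 1 := ⟨n - 1, by omega⟩
  obtain ⟨α, rfl⟩ : ∃ α, a = α + (N + 1 : ℕ) := ⟨a - (N + 1 : ℕ), by ring⟩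
  obtain ⟨γ, rfl⟩ : ∃ γ, c = γ + (N + 1 : ℕ) := ⟨c - (N + 1 : ℕ), by ring⟩
  have e1 : α + ((N + 1 : ℕ) : ℂ) - ((N + 1 : ℕ) : ℂ) = α := by ring
  have e2 : α + ((N + 1 : ℕ) : ℂ) - 1 - ((N + 1 : ℕ) : ℂ) = α - 1 := by ring
  have e3 : γ + ((N + 1 : ℕ) : ℂ) - 1 - ((N + 1 : ℕ) : ℂ) - b = γ - 1 - b := by ring
  have e4 : γ + ((N + 1 : ℕ) : ℂ) - ((N + 1 : ℕ) : ℂ) - 1 = γ - 1 := by ring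
  have e5 : γ + ((N + 1 : ℕ) : ℂ) - b = γ - b + N + 1 := by push_cast; ring
  rw [e1] at h0
  rw [e2] at ha
  rw [e3] at hs h
  have hα : ¬ IsGammaPole α := by simpa using not_isGammaPole_add_one ha
  have hα' := not_isGammaPole_add_one hα
  have hγ : ¬ IsGammaPole (γ - b) := by
    rw [show γ - b = γ - 1 - b + 1 by ring]
    exact not_isGammaPole_add_one hs
  have eS : ∀ k : ℕ, Gamma (α - 1 + k) * Gamma (γ - 1 - b + k) /
      (Gamma (k + 1) * Gamma (γ - 1 + k)) = Gamma (α - 1 + k) * Gamma (γ - 1 - b + k) *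
        (k.factorial * Gamma (γ - 1 + k))⁻¹ := by
    intro k
    rw [Gamma_nat_eq_factorial, div_eq_mul_inv]
  simp only [e1, e2, e3, e4, e5, eS]
  have hs0 : b - γ + 1 ≠ 0 := fun h => ne_zero_of_not_isGammaPole hs (by linear_combination -h)
  have key := (hasSum_mul_threeTwoTerm_one h (hasSum_threeTwoTerm_one hα hγ h N)).mul_left
    (Gamma (γ + (N + 1 : ℕ)) * Gamma (α + 1) * (b - γ + 1)⁻¹)
  convert! key using 1
  · funext k
    have hk : (k.factorial : ℂ) ≠ 0 := Nat.cast_ne_zero.2 k.factorial_ne_zero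
    rw [hyperTerm_three_two, inv_rising_eq hc, inv_rising_eq hα', threeTwoTerm, rising_two,
      rising_one]
    have := inv_mul_cancel₀ hs0
    linear_combination -rising (α + (N + 1 : ℕ)) k * rising b k * k.factorial * (k + 1) *
      (Gamma (γ + (N + 1 : ℕ)) * (Gamma (γ + (N + 1 : ℕ) + k))⁻¹) *
      (Gamma (α + 1) * (Gamma (α + 1 + k))⁻¹) * (k.factorial : ℂ)⁻¹ * this
  · have hsum := sum_Gamma_contiguous ha hs (N + 1)
    set T := ∑ m ∈ Finset.range (N + 1 + 1),
      Gamma (α - 1 + m) * Gamma (γ - 1 - b + m) * (m.factorial * Gamma (γ - 1 + m))⁻¹ with hT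
    clear_value T
    have hcG := Gamma_ne_zero_of_not_isGammaPole hc
    have hαG := Gamma_ne_zero_of_not_isGammaPole hα
    have hα0 := ne_zero_of_not_isGammaPole hα
    have g1 := Gamma_ne_zero_of_not_isGammaPole
      (not_isGammaPole_add_one (not_isGammaPole_add_nat hα N))
    have g2 := Gamma_ne_zero_of_not_isGammaPole
      (not_isGammaPole_add_one (not_isGammaPole_add_nat hγ N))
    have hN! : (N.factorial : ℂ) ≠ 0 := Nat.cast_ne_zero.2 N.factorial_ne_zero
    have hN1 : (N : ℂ) + 1 ≠ 0 := Nat.cast_add_one_ne_zero N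
    have eN : Gamma ((N + 1 : ℕ) : ℂ) = N.factorial := by
      rw [Nat.cast_succ, Gamma_nat_eq_factorial]
    have h3 : (Gamma (γ - 1 + (N + 1 : ℕ)))⁻¹ = (γ + N) * (Gamma (γ + (N + 1 : ℕ)))⁻¹ := by
      rw [inv_Gamma_eq]
      push_cast
      ring_nf
    rw [mul_inv, h3, Nat.factorial_succ] at hsum
    rw [eN, Complex.Gamma_add_one _ hα0]
    have hU : ∑ m ∈ Finset.range (N + 1),
        Gamma (γ - b + m) * Gamma (α + m) * (m.factorial * Gamma (γ + m))⁻¹ =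
        (Gamma (α + N + 1) * Gamma (γ - b + N + 1) * ((((N : ℂ) + 1) * N.factorial)⁻¹ *
          ((γ + N) * (Gamma (γ + (N + 1 : ℕ)))⁻¹)) - (α - 1) * (γ - 1 - b) * T) *
          (α - b)⁻¹ := by
      rw [eq_mul_inv_iff_mul_eq₀ h0]
      push_cast at hsum ⊢
      simp only [← add_assoc] at hsum ⊢
      linear_combination hsum
    rw [hU]
    push_cast at hcG ⊢
    simp only [← add_assoc] at hcG ⊢
    field_simp
    ring

/-! ### The terminating series -/

lemma eventually_threeTwoTerm_neg_eq_zero (a b d e : ℂ) (n : ℕ) :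
    ∀ᶠ k in atTop, threeTwoTerm a b (-(n : ℂ)) d e k = 0 :=
  (eventually_rising_eq_zero ⟨n, rfl⟩).mono fun k hk => by simp [threeTwoTerm, hk]

lemma summable_of_eventually_zero {f : ℕ → ℂ} (h : ∀ᶠ k in atTop, f k = 0) : Summable f :=
  (PowerGrowth.of_eventually_zero h (-2)).summable (by norm_num)

lemma tendsto_of_eventually_zero {f : ℕ → ℂ} (h : ∀ᶠ k in atTop, f k = 0) :
    Tendsto f atTop (𝓝 0) :=
  (PowerGrowth.of_eventually_zero h 0).tendsto_of_zero

/-- Replacing `s` and `a` by `u`, `v`, `w`, tied only by v = 1 + u + b - w, removes the products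
with `n` from the parameters; the recursion then runs over `n` with everything else fixed. -/
lemma hasSum_terminating_succ {b u v w S : ℂ} {n : ℕ} (hv : v = 1 + u + b - w)
    (hS : HasSum (threeTwoTerm 1 v (-(n : ℂ)) (b + 1) (u + 1)) S) :
    HasSum (fun k => (b + n + 1) * (u + n + 1) *
        threeTwoTerm 1 v (-((n + 1 : ℕ) : ℂ)) (b + 1) (u + 1) k)
      ((n + 1) * (w + n) * S + (Gamma b)⁻¹ * (Gamma u)⁻¹) := by
  have h0 := eventually_threeTwoTerm_neg_eq_zero 1 v (b + 1) (u + 1) (n + 1)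
  set H : ℕ → ℂ := fun k => -((b + k) * (u + k) *
    threeTwoTerm 1 v (-((n + 1 : ℕ) : ℂ)) (b + 1) (u + 1) k) with hH
  have hlim : Tendsto H atTop (𝓝 0) := tendsto_of_eventually_zero (h0.mono fun k hk => by
    simp only [hH]
    rw [hk]
    ring)
  have key := hasSum_of_telescoping (H := H)
    ((summable_of_eventually_zero h0).mul_left ((b + n + 1) * (u + n + 1)))
    (hS.mul_left ((n + 1) * (w + n))) (fun k => ?_) hlim
  · convert! key using 1
    rw [hH, inv_Gamma_eq b, inv_Gamma_eq u]
    simp only [threeTwoTerm_apply_zero, Nat.cast_zero]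
    ring
  · have h1 := threeTwoTerm_one_succ v (-((n + 1 : ℕ) : ℂ)) (b + 1) (u + 1) k
    have h2 := mul_threeTwoTerm_add_one_top 1 v (-((n + 1 : ℕ) : ℂ)) (b + 1) (u + 1) k
    rw [show -((n + 1 : ℕ) : ℂ) + 1 = -n by push_cast; ring] at h2
    simp only [hH]
    subst hv
    push_cast at h1 h2 ⊢
    linear_combination (w + n) * h2 + h1

/-- The identity is divided by Γ(w + n) so that the induction can pass through indices at which w +
n is a pole. -/
lemma exists_hasSum_terminating {b u v w : ℂ} (hb : ¬ IsGammaPole b) (hu : ¬ IsGammaPole u)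
    (hv : v = 1 + u + b - w) (n : ℕ) :
    ∃ S : ℂ, HasSum (threeTwoTerm 1 v (-(n : ℂ)) (b + 1) (u + 1)) S ∧
      S * (Gamma (w + n))⁻¹ = n.factorial *
        (Gamma b * Gamma u * Gamma (b + n + 1) * Gamma (u + n + 1))⁻¹ *
        ∑ L ∈ Finset.range (n + 1),
          Gamma (u + L) * Gamma (b + L) * (L.factorial * Gamma (w + L))⁻¹ := by
  have hbG := Gamma_ne_zero_of_not_isGammaPole hb
  have huG := Gamma_ne_zero_of_not_isGammaPole hu
  induction n with
  | zero =>
    refine ⟨(Gamma (b + 1))⁻¹ * (Gamma (u + 1))⁻¹, ?_, ?_⟩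
    · rw [← threeTwoTerm_apply_zero 1 v (-((0 : ℕ) : ℂ))]
      refine hasSum_single 0 fun k hk => ?_
      rw [threeTwoTerm, rising_neg_eq_zero (Nat.pos_of_ne_zero hk)]
      ring
    · simp only [Nat.cast_zero, add_zero, zero_add, Finset.sum_range_one, Nat.factorial_zero,
        Nat.cast_one, one_mul, mul_inv]
      generalize (Gamma w)⁻¹ = G
      field_simp
  | succ n ih =>
    obtain ⟨S, hS, hSw⟩ := ih
    have n1 := ne_zero_of_not_isGammaPole (not_isGammaPole_add_one (not_isGammaPole_add_nat hb n))
    have n2 := ne_zero_of_not_isGammaPole (not_isGammaPole_add_one (not_isGammaPole_add_nat hu n))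
    have g1 := Gamma_ne_zero_of_not_isGammaPole
      (not_isGammaPole_add_one (not_isGammaPole_add_nat hb n))
    have g2 := Gamma_ne_zero_of_not_isGammaPole
      (not_isGammaPole_add_one (not_isGammaPole_add_nat hu n))
    refine ⟨((b + n + 1) * (u + n + 1))⁻¹ *
      ((n + 1) * (w + n) * S + (Gamma b)⁻¹ * (Gamma u)⁻¹), ?_, ?_⟩
    · convert! (hasSum_terminating_succ hv hS).mul_left ((b + n + 1) * (u + n + 1))⁻¹ using 1
      funext k
      rw [inv_mul_cancel_left₀ (mul_ne_zero n1 n2)]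
    · rw [Finset.sum_range_succ _ (n + 1)]
      generalize ∑ L ∈ Finset.range (n + 1),
          Gamma (u + L) * Gamma (b + L) * (L.factorial * Gamma (w + L))⁻¹ = T at *
      have hn! : (n.factorial : ℂ) ≠ 0 := Nat.cast_ne_zero.2 n.factorial_ne_zero
      have hn1 : (n : ℂ) + 1 ≠ 0 := Nat.cast_add_one_ne_zero n
      rw [inv_Gamma_eq (w + n)] at hSw
      rw [Nat.factorial_succ]
      push_cast
      simp only [← add_assoc, mul_inv] at hSw ⊢
      rw [Complex.Gamma_add_one _ n1, Complex.Gamma_add_one _ n2]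
      generalize (Gamma (w + n + 1))⁻¹ = G at *
      have e : ((b + n + 1)⁻¹ * (u + n + 1)⁻¹ *
          ((n + 1) * (w + n) * S + (Gamma b)⁻¹ * (Gamma u)⁻¹)) * G =
          (b + n + 1)⁻¹ * (u + n + 1)⁻¹ * ((n + 1) * (S * ((w + n) * G)) +
            (Gamma b)⁻¹ * (Gamma u)⁻¹ * G) := by ring
      rw [e, hSw]
      field_simp

lemma hasSum_mul_terminating {b u v w S : ℂ} {n : ℕ} (hv : v = 1 + u + b - w)
    (hS : HasSum (threeTwoTerm 1 v (-(n : ℂ)) (b + 1) (u + 1)) S) :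
    HasSum (fun k : ℕ => (1 - w - n) * (k * threeTwoTerm 1 v (-(n : ℂ)) (b + 1) (u + 1) k))
      ((v * n + b * u) * S - (Gamma b)⁻¹ * (Gamma u)⁻¹) := by
  have h0 := eventually_threeTwoTerm_neg_eq_zero 1 v (b + 1) (u + 1) n
  set H : ℕ → ℂ := fun k => (b + k) * (u + k) *
    threeTwoTerm 1 v (-(n : ℂ)) (b + 1) (u + 1) k with hH
  have hsum : Summable fun k : ℕ =>
      (k : ℂ) * threeTwoTerm 1 v (-(n : ℂ)) (b + 1) (u + 1) k :=
    summable_of_eventually_zero (h0.mono fun k hk => by rw [hk, mul_zero])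
  have hlim : Tendsto H atTop (𝓝 0) := tendsto_of_eventually_zero (h0.mono fun k hk => by
    simp only [hH]
    rw [hk]
    ring)
  have key := hasSum_of_telescoping (H := H)
    (hsum.mul_left (1 - w - n))
    (hS.mul_left (v * n + b * u)) (fun k => ?_) hlim
  · convert! key using 1
    rw [hH, inv_Gamma_eq b, inv_Gamma_eq u]
    simp only [threeTwoTerm_apply_zero, Nat.cast_zero]
    ring
  · have h1 := threeTwoTerm_one_succ v (-(n : ℂ)) (b + 1) (u + 1) k
    simp only [hH]
    subst hv
    push_cast
    linear_combination -h1

/-- The evaluation of the terminating `₃F₂(2, 1 + sb - a, 1 - n; b + 2, 2 - a - ns | 1)`. -/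
lemma hasSum_terminating_top_two {n : ℕ} (hn : 0 < n) {s a b : ℂ} (hs : s ≠ 1)
    (hsb : s * b - a ≠ 0) (hb : ¬ IsGammaPole b) (hu : ¬ IsGammaPole (-a - n * s))
    (hw : ¬ IsGammaPole (1 - n * s + n + b - s * b)) :
    HasSum (hyperTerm [2, 1 + s * b - a, 1 - (n : ℂ)] [b + 2, 2 - a - n * s] 1)
        ((b + 1) * (a - 1 + n * s) * (a + n * s) * a * b *
            Gamma n * Gamma (1 - n * s + n + b - s * b) /
            ((s * b - a) * (s - 1) * Gamma (b + n + 1) * Gamma (1 - a - n * s + n)) *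
            ∑ L ∈ Finset.range (n + 1),
              Gamma (-a - n * s + L) * Gamma (b + L) /
                (Gamma (L + 1) * Gamma (1 - n * s + b - s * b + L)) +
          b * (a + n * s) * (-1 + a + n * s) * (b + 1) /
            (n * (s - 1) * (s * b - a) * (b + n))) := by
  obtain ⟨u, hu'⟩ : ∃ u, u = -a - n * s := ⟨_, rfl⟩
  obtain ⟨w, hw'⟩ : ∃ w, w = 1 - n * s + b - s * b := ⟨_, rfl⟩
  obtain ⟨v, hv'⟩ : ∃ v, v = s * b - a := ⟨_, rfl⟩
  have hv : v = 1 + u + b - w := by rw [hv', hu', hw']; ring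
  have e1 : 1 - n * s + n + b - s * b = w + n := by rw [hw']; ring
  have e2 : 1 - a - n * s + n = u + n + 1 := by rw [hu']; ring
  have e3 : 2 - a - n * s = u + 2 := by rw [hu']; ring
  have e4 : 1 + s * b - a = v + 1 := by rw [hv']; ring
  rw [← hu'] at hu
  rw [e1] at hw
  rw [← hv'] at hsb
  rw [e1, e2, e3, e4, ← hu', ← hw', ← hv']
  have hn0 : (n : ℂ) ≠ 0 := Nat.cast_ne_zero.2 hn.ne'
  have hs1 : s - 1 ≠ 0 := sub_ne_zero.2 hs
  have hbn := add_nat_ne_zero hb n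
  have hwn : (1 - w - n : ℂ) = (s - 1) * (b + n) := by rw [hw']; ring
  have hvn : v * n + b * u = -a * (b + n) := by rw [hv', hu']; ring
  have hb1 := not_isGammaPole_add_one hb
  have hu1 := not_isGammaPole_add_one hu
  obtain ⟨S, hS, hSw⟩ := exists_hasSum_terminating hb hu hv n
  -- The weight `k` kills the term at k = 0. The shift k → k + 1 then raises every parameter by one,
  -- turning the top parameter 1 into 2 and -n into 1 - n.
  have h1 := (hasSum_nat_add_iff' 1).2 (hasSum_mul_terminating hv hS)
  have key := h1.mul_left (Gamma (b + 1) * Gamma (u + 1) * (b + 1) * (u + 1) *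
    (-(v * n * ((s - 1) * (b + n))))⁻¹)
  have hG1 := Gamma_ne_zero_of_not_isGammaPole hb
  have hG2 := Gamma_ne_zero_of_not_isGammaPole hu
  have hG3 := Gamma_ne_zero_of_not_isGammaPole hw
  have hG4 := Gamma_ne_zero_of_not_isGammaPole (not_isGammaPole_add_one
    (not_isGammaPole_add_nat hb n))
  have hG5 := Gamma_ne_zero_of_not_isGammaPole (not_isGammaPole_add_one
    (not_isGammaPole_add_nat hu n))
  have hb0 := ne_zero_of_not_isGammaPole hb
  have hu0 := ne_zero_of_not_isGammaPole hu
  convert! key using 1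
  · funext k
    have hk : (k.factorial : ℂ) ≠ 0 := Nat.cast_ne_zero.2 k.factorial_ne_zero
    have hk1 : (k : ℂ) + 1 ≠ 0 := Nat.cast_add_one_ne_zero k
    have n1 := ne_zero_of_not_isGammaPole hb1
    have n2 := ne_zero_of_not_isGammaPole hu1
    have r1 := rising_ne_zero (not_isGammaPole_add_one hb1) k
    have r2 := rising_ne_zero (not_isGammaPole_add_one hu1) k
    rw [show b + 1 + 1 = b + 2 by ring] at r1
    rw [show u + 1 + 1 = u + 2 by ring] at r2
    have hE : Gamma (b + 1) * Gamma (u + 1) *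
        threeTwoTerm 1 v (-(n : ℂ)) (b + 1) (u + 1) (k + 1) =
        v * rising (v + 1) k * (-n * rising (1 - n) k) *
          ((b + 1) * rising (b + 2) k)⁻¹ * ((u + 1) * rising (u + 2) k)⁻¹ := by
      have i1 := inv_rising_eq hb1 (k + 1)
      have i2 := inv_rising_eq hu1 (k + 1)
      rw [rising_succ_left, show b + 1 + 1 = b + 2 by ring] at i1
      rw [rising_succ_left, show u + 1 + 1 = u + 2 by ring] at i2
      rw [i1, i2, threeTwoTerm, rising_one, rising_succ_left v, rising_succ_left (-(n : ℂ)),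
        show -(n : ℂ) + 1 = 1 - n by ring]
      have hk2 : ((k + 1).factorial : ℂ) ≠ 0 := Nat.cast_ne_zero.2 (k + 1).factorial_ne_zero
      generalize (Gamma (b + 1 + ((k + 1 : ℕ) : ℂ)))⁻¹ = G₁
      generalize (Gamma (u + 1 + ((k + 1 : ℕ) : ℂ)))⁻¹ = G₂
      field_simp
    rw [hyperTerm_three_two, rising_two, hwn]
    push_cast
    have hfactor : ∀ c d p q r t x : ℂ, c * d * p * q * r⁻¹ * (t * ((k + 1) * x)) =
        c * d * x * (p * q * r⁻¹ * t * (k + 1)) := fun _ _ _ _ _ _ _ => by ring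
    rw [hfactor, hE]
    field_simp
  · have hS' : S = n.factorial *
        (Gamma b * Gamma u * Gamma (b + n + 1) * Gamma (u + n + 1))⁻¹ *
        (∑ L ∈ Finset.range (n + 1),
          Gamma (u + L) * Gamma (b + L) * (L.factorial * Gamma (w + L))⁻¹) * Gamma (w + n) := by
      rw [← hSw]
      field_simp
    have eS : ∀ k : ℕ, Gamma (u + k) * Gamma (b + k) / (Gamma (k + 1) * Gamma (w + k)) =
        Gamma (u + k) * Gamma (b + k) * (k.factorial * Gamma (w + k))⁻¹ := by
      intro k
      rw [Gamma_nat_eq_factorial, div_eq_mul_inv]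
    simp only [eS]
    rw [hvn, hS']
    generalize ∑ L ∈ Finset.range (n + 1),
          Gamma (u + L) * Gamma (b + L) * (L.factorial * Gamma (w + L))⁻¹ = T
    rw [Complex.Gamma_add_one _ hb0, Complex.Gamma_add_one _ hu0]
    simp only [Finset.sum_range_one, Nat.cast_zero, zero_mul, mul_zero, sub_zero]
    obtain ⟨N, rfl⟩ : ∃ N, n = N + 1 := ⟨n - 1, by omega⟩
    have eN : Gamma ((N + 1 : ℕ) : ℂ) = N.factorial := by
      rw [Nat.cast_succ, Gamma_nat_eq_factorial]
    rw [eN, Nat.factorial_succ, Nat.cast_mul]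
    have ha : a = -u - ((N + 1 : ℕ) : ℂ) * s := by rw [hu']; ring
    rw [show a - 1 + ((N + 1 : ℕ) : ℂ) * s = -(u + 1) by rw [ha]; ring,
      show a + ((N + 1 : ℕ) : ℂ) * s = -u by rw [ha]; ring,
      show -1 + a + ((N + 1 : ℕ) : ℂ) * s = -(u + 1) by rw [ha]; ring]
    generalize ((N + 1 : ℕ) : ℂ) = n at *
    field_simp
    ring

/-! ### Reduction of the ₄F₃ -/

lemma hyperTerm_four_three (a b c d p q r : ℂ) (k : ℕ) :
    hyperTerm [a, b, c, d] [p, q, r] 1 k =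
      rising a k * rising b k * rising c k * rising d k * (rising p k)⁻¹ * (rising q k)⁻¹ *
        (rising r k)⁻¹ * (k.factorial : ℂ)⁻¹ := by
  simp only [hyperTerm, List.map_cons, List.map_nil, List.prod_cons, List.prod_nil, one_pow,
    mul_one, rising, div_eq_mul_inv, mul_inv]
  ring

/-- The reduction of the terminating `₄F₃` to two terminating `₃F₂`. -/
lemma hyperF_four_three_reduction (n : ℕ) {s a b : ℂ}
    (hx : ∀ j < n, a / (s - 1) + (j : ℂ) ≠ 0) :
    hyperF [1, 1 + a / (s - 1), b * s - a, -(n : ℂ)]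
        [a / (s - 1), b + 1, 1 - a - n * s] 1 =
      hyperF [1, b * s - a, -(n : ℂ)] [b + 1, 1 - a - n * s] 1 -
        (s - 1) * (s * b - a) * n / (a * (b + 1) * (1 - a - n * s)) *
          hyperF [2, 1 + b * s - a, 1 - (n : ℂ)] [b + 2, 2 - a - n * s] 1 := by
  obtain ⟨x, hx'⟩ : ∃ x, x = a / (s - 1) := ⟨_, rfl⟩
  obtain ⟨e, he⟩ : ∃ e, e = 1 - a - n * s := ⟨_, rfl⟩
  obtain ⟨B, hB⟩ : ∃ B, B = b * s - a := ⟨_, rfl⟩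
  have hc : (s - 1) * (s * b - a) * n / (a * (b + 1) * (1 - a - n * s)) =
      -(x⁻¹ * (B * -n * ((b + 1) * e)⁻¹)) := by
    rw [hx', he, hB]
    simp only [div_eq_mul_inv, mul_inv, inv_inv]
    ring
  rw [hc, show 2 - a - n * s = e + 1 by rw [he]; ring,
    show 1 + b * s - a = B + 1 by rw [hB]; ring, ← hx', ← he, ← hB]
  rw [← hx'] at hx
  have hz : ∀ k, n < k → rising (-(n : ℂ)) k = 0 := fun k hk => rising_neg_eq_zero hk
  have hD0 : ∀ᶠ k in atTop, hyperTerm [1, B, -(n : ℂ)] [b + 1, e] 1 k = 0 := by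
    filter_upwards [eventually_gt_atTop n] with k hk
    rw [hyperTerm_three_two, hz k hk]
    ring
  have hkD0 : ∀ᶠ k : ℕ in atTop, k * hyperTerm [1, B, -(n : ℂ)] [b + 1, e] 1 k = 0 :=
    hD0.mono fun k hk => by rw [hk, mul_zero]
  -- The quotient of the rising factorials of 1 + x and x is 1 + k/x. For k > n the numerator
  -- vanishes, so only the factors x + j with j < n have to be nonzero.
  have hA : ∀ k, hyperTerm [1, 1 + x, B, -(n : ℂ)] [x, b + 1, e] 1 k =
      hyperTerm [1, B, -(n : ℂ)] [b + 1, e] 1 k +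
        x⁻¹ * (k * hyperTerm [1, B, -(n : ℂ)] [b + 1, e] 1 k) := by
    intro k
    rw [hyperTerm_four_three, hyperTerm_three_two]
    rcases lt_or_ge n k with hk | hk
    · rw [hz k hk]
      ring
    rcases k.eq_zero_or_pos with rfl | hk0
    · simp [rising_zero]
    have hx0 : x ≠ 0 := by simpa using hx 0 (hk0.trans_le hk)
    have hxk : rising x k ≠ 0 := by
      rw [rising_eq_prod]
      exact Finset.prod_ne_zero_iff.2 fun j hj => hx j ((Finset.mem_range.1 hj).trans_le hk)
    have h1 := mul_rising_add_one x k
    have h2 : rising (1 + x) k * (rising x k)⁻¹ = 1 + x⁻¹ * k := by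
      rw [add_comm 1 x]
      field_simp
      linear_combination h1
    linear_combination rising 1 k * rising B k * rising (-(n : ℂ)) k * (rising (b + 1) k)⁻¹ *
      (rising e k)⁻¹ * (k.factorial : ℂ)⁻¹ * h2
  -- The weight `k` removes the term at k = 0; shifting the index raises all parameters by one and
  -- pulls out their first factors.
  have hshift : ∀ k : ℕ, ((k + 1 : ℕ) : ℂ) * hyperTerm [1, B, -(n : ℂ)] [b + 1, e] 1 (k + 1) =
      B * -n * ((b + 1) * e)⁻¹ * hyperTerm [2, B + 1, 1 - (n : ℂ)] [b + 2, e + 1] 1 k := by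
    intro k
    have hk1 : ((k : ℂ) + 1) * ((k : ℂ) + 1)⁻¹ = 1 := mul_inv_cancel₀ (Nat.cast_add_one_ne_zero k)
    rw [hyperTerm_three_two, hyperTerm_three_two, rising_one, rising_two, rising_succ_left B,
      rising_succ_left (-(n : ℂ)), rising_succ_left (b + 1), rising_succ_left e,
      show -(n : ℂ) + 1 = 1 - n by ring, show b + 1 + 1 = b + 2 by ring, Nat.factorial_succ]
    push_cast
    simp only [mul_inv]
    linear_combination ((k : ℂ) + 1) * (k.factorial : ℂ) * (k.factorial : ℂ)⁻¹ * B *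
      rising (B + 1) k * -n * rising (1 - n) k * (b + 1)⁻¹ * (rising (b + 2) k)⁻¹ * e⁻¹ *
      (rising (e + 1) k)⁻¹ * hk1
  have hsD := summable_of_eventually_zero hD0
  have hskD := summable_of_eventually_zero hkD0
  unfold hyperF
  rw [tsum_congr hA, hsD.tsum_add (hskD.mul_left _), tsum_mul_left, hskD.tsum_eq_zero_add,
    tsum_congr hshift, tsum_mul_left]
  simp only [Nat.cast_zero, zero_mul, zero_add]
  ring

end

theorem mainTheorem9 (n : ℕ) (hn : 0 < n) :
    -- reduction of the terminating 4F3
    (∀ s a b : ℂ, s ≠ 1 →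
      (∀ j < n, a / (s - 1) + (j : ℂ) ≠ 0) →
      (∀ j < n, b + 1 + (j : ℂ) ≠ 0) →
      (∀ j < n, 1 - a - n * s + (j : ℂ) ≠ 0) →
      hyperF [1, 1 + a / (s - 1), b * s - a, -(n : ℂ)]
          [a / (s - 1), b + 1, 1 - a - n * s] 1 =
        hyperF [1, b * s - a, -(n : ℂ)] [b + 1, 1 - a - n * s] 1 -
          (s - 1) * (s * b - a) * n / (a * (b + 1) * (1 - a - n * s)) *
            hyperF [2, 1 + b * s - a, 1 - (n : ℂ)] [b + 2, 2 - a - n * s] 1) ∧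
    -- evaluation of the terminating 3F2
    (∀ s a b : ℂ, s ≠ 1 → s * b - a ≠ 0 →
      ¬ IsGammaPole b →
      ¬ IsGammaPole (-a - n * s) →
      ¬ IsGammaPole (1 - n * s + n + b - s * b) →
      HasSum (hyperTerm [2, 1 + s * b - a, 1 - (n : ℂ)] [b + 2, 2 - a - n * s] 1)
        ((b + 1) * (a - 1 + n * s) * (a + n * s) * a * b *
            Gamma n * Gamma (1 - n * s + n + b - s * b) /
            ((s * b - a) * (s - 1) * Gamma (b + n + 1) * Gamma (1 - a - n * s + n)) *
            ∑ L ∈ Finset.range (n + 1),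
              Gamma (-a - n * s + L) * Gamma (b + L) /
                (Gamma (L + 1) * Gamma (1 - n * s + b - s * b + L)) +
          b * (a + n * s) * (-1 + a + n * s) * (b + 1) /
            (n * (s - 1) * (s * b - a) * (b + n)))) ∧
    -- 3F2(a, a-n-1, b; c, a-n+1 | 1)
    (∀ a b c : ℂ, b ≠ 1 →
      ¬ IsGammaPole c →
      ¬ IsGammaPole (a - 1 - n) →
      ¬ IsGammaPole (c - a) →
      ¬ IsGammaPole (-b + 2 + c - a) →
      (0 < (-b + 2 + c - a).re ∨ IsGammaPole b) →
      HasSum (hyperTerm [a, a - n - 1, b] [c, a - n + 1] 1)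
        (-((a - n) * (a - n - 1) *
              (-b * n - a * c + n * c + a ^ 2 - a * n + c - a + n) *
              Gamma (-b + 2 + c - a) * Gamma c * Gamma n *
              ∑ k ∈ Finset.range (n + 1),
                Gamma (a - 1 - n + k) * Gamma (c - a + k) /
                  (Gamma (k + 1) * Gamma (1 - n + c - b + k))) /
            ((b - 1) * Gamma (n + c + 1 - a) * Gamma (c - a) * Gamma a) -
          (a - n) * (a - n - 1) * Gamma (-b + 2 + c - a) * Gamma c /
            (n * (b - 1) * Gamma (c + 1 - b) * Gamma (c - a)))) ∧
    -- 3F2(a, b, c; n+1+c+b, a-n+1 | 1)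
    (∀ a b c : ℂ, a - c - b - n ≠ 0 →
      ¬ IsGammaPole (n + 1 + c + b) →
      ¬ IsGammaPole (a - n + 1) →
      ¬ IsGammaPole b →
      ¬ IsGammaPole c →
      HasSum (hyperTerm [a, b, c] [n + 1 + c + b, a - n + 1] 1)
        (Gamma (n + 1 + c + b) * Gamma (a - n + 1) *
            (-(n : ℂ) ^ 2 * c + (n : ℂ) ^ 2 * a - (n : ℂ) ^ 3 - (n : ℂ) ^ 2 * b - n * c * b) *
            Gamma n *
            (∑ k ∈ Finset.range (n + 1),
              Gamma (b + k) * Gamma (c + k) / (Gamma (k + 1) * Gamma (a + 1 + k - n))) /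
            ((a - c - b - n) * Gamma c * Gamma b * Gamma (c + n + 1) * Gamma (b + n + 1) * n) +
          Gamma (n + 1 + c + b) * Gamma (a - n + 1) /
            (n * (a - c - b - n) * Gamma (1 + a) * Gamma c * Gamma b))) ∧
    -- 3F2(a, b, c; 2+a, a-n+1 | 1)
    (∀ a b c : ℂ,
      ¬ IsGammaPole (a - n + 1) →
      ¬ IsGammaPole (a + 2 - b - c - n) →
      ¬ IsGammaPole (a + 1 - n - c) →
      ¬ IsGammaPole (-b - n + 1 + a) →
      (0 < (a - b - c - n + 3).re ∨ IsGammaPole b ∨ IsGammaPole c) →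
      HasSum (hyperTerm [a, b, c] [2 + a, a - n + 1] 1)
        ((n * c * b - n * c - a * n * c - a * n * b + n + 2 * a * n - b * n
                - (n : ℂ) ^ 2 * a + n * a ^ 2) *
            Gamma (2 + a) * Gamma (a + 2 - b - c - n) * Gamma (a - n + 1) * Gamma n *
            (∑ k ∈ Finset.range (n + 1),
              Gamma (a + k + 1 - n - c) * Gamma (-b - n + 1 + a + k) /
                (Gamma (k + 1) * Gamma (a + 1 + k - n))) /
            (n * Gamma (-b - n + 1 + a) * Gamma (2 + a - b) * Gamma (2 + a - c) *
              Gamma (1 + a - c - n)) +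
          Gamma (a + 2 - b - c - n) * (-1 - a) * Gamma (a - n + 1) /
            (Gamma (-b - n + 1 + a) * n * Gamma (1 + a - c - n)))) ∧
    -- 3F2(a, b, 2; c, a-n+1 | 1)
    (∀ a b c : ℂ, a - n - b ≠ 0 →
      ¬ IsGammaPole c →
      ¬ IsGammaPole (a - 1 - n) →
      ¬ IsGammaPole (c - 1 - n - b) →
      (0 < (c - 1 - n - b).re ∨ IsGammaPole b) →
      HasSum (hyperTerm [a, b, 2] [c, a - n + 1] 1)
        (-((a - n - 1) * (a - n) *
              (a * b - b - 1 - 2 * n + a - a * c + n * c + c) * Gamma c * Gamma n *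
              ∑ k ∈ Finset.range (n + 1),
                Gamma (a - 1 - n + k) * Gamma (c - 1 - n - b + k) /
                  (Gamma (k + 1) * Gamma (c - n - 1 + k))) /
            ((a - n - b) * Gamma a * Gamma (c - b)) -
          (a - n - 1) * (a - n) * (c - 1) / (n * (a - n - b)))) := by
  exact ⟨fun _ _ _ _ hx _ _ => hyperF_four_three_reduction n hx,
    fun _ _ _ hs hsb hb hu hw => hasSum_terminating_top_two hn hs hsb hb hu hw,
    fun _ _ _ hb hc ha hca hσ h => hasSum_top_bottom_gap_two hn hb hc ha hca hσ h,
    fun _ _ _ h0 hd hf hb hc => hasSum_balanced_two hn h0 hd hf hb hc,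
    fun _ _ _ hf hs hfc hfb h => hasSum_bottom_gap_two hn hf hs hfc hfb h,
    fun _ _ _ h0 hc ha hs h => hasSum_top_two hn h0 hc ha hs h⟩
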